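/- Let $S=\mathbb{C}[x,y,z]$. For a line arrangement $\mathcal{A}$ in the complex projective plane $\mathbb{P}^2$ consisting of $d$ distinct lines $\ell_1=0,\dots,\ell_d=0$, put $f=\ell_1\cdots\ell_d$, and let $AR(f)=\{(a,b,c)\in S^3 : af_x+bf_y+cf_z=0\}$ be the graded $S$-module of Jacobian syzygies. The arrangement $\mathcal{A}$ is called free with exponents $d_1\le d_2$ (non-negative integers) if $AR(f)\cong S(-d_1)\oplus S(-d_2)$ as graded $S$-modules, and free if this holds for some $d_1\le d_2$. The intersection lattice $L(\mathcal{A})$ is the set of all intersections of families of lines of $\mathcal{A}$, where each line is regarded as a plane through the origin in $\mathbb{C}^3$ and the empty intersection is $\mathbb{C}^3$, partially ordered by reverse inclusion. Let $m(\mathcal{A})$ be the maximal multiplicity of an intersection point of $\mathcal{A}$, that is, the largest number of lines of $\mathcal{A}$ passing through a point that lies on at least two of them (with $m(\mathcal{A})=0$ if there is no such point). Theorem. Let $\mathcal{A}$ be a line arrangement in $\mathbb{P}^2$ that is free with exponents $d_1\le d_2$, and assume that $m(\mathcal{A})\ge d_1$. Then Terao's conjecture holds for $\mathcal{A}$: every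 line arrangement $\mathcal{B}$ in $\mathbb{P}^2$ whose intersection lattice $L(\mathcal{B})$ is isomorphic to $L(\mathcal{A})$ is also free. -/

import Mathlib

/-- The polynomial ring `S = ℂ[x, y, z]`, with its grading by total degree. -/
abbrev PolyS : Type := MvPolynomial (Fin 3) ℂ

/-- The module `AR(f)` of Jacobian syzygies: all triples `(a, b, c) ∈ S³` with
`a f_x + b f_y + c f_z = 0`. -/
noncomputable def jacobianSyzygies (f : PolyS) : Submodule PolyS (Fin 3 → PolyS) :=
  LinearMap.ker (Fintype.linearCombination PolyS (fun i => MvPolynomial.pderiv i f))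

theorem mem_jacobianSyzygies (f : PolyS) (a : Fin 3 → PolyS) :
    a ∈ jacobianSyzygies f ↔ ∑ i, a i * MvPolynomial.pderiv i f = 0 := by
  simp [jacobianSyzygies, Fintype.linearCombination_apply]

/-- The curve `f = 0` is free with exponents `d₁ ≤ d₂`: the graded `S`-module `AR(f)` is isomorphic
to `S(-d₁) ⊕ S(-d₂)`, i.e. it has an `S`-basis consisting of one homogeneous syzygy of degree `d₁`
and one of degree `d₂` (a triple is homogeneous of degree `k` when its three entries are). -/
def IsFreeWithExponents (f : PolyS) (d₁ d₂ : ℕ) : Prop :=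
  d₁ ≤ d₂ ∧ ∃ b : Module.Basis (Fin 2) PolyS (jacobianSyzygies f),
    ∀ (j : Fin 2) (i : Fin 3), ((b j : Fin 3 → PolyS) i).IsHomogeneous (![d₁, d₂] j)

/-- The curve `f = 0` is free: it is free with some exponents. -/
def IsFreeCurve (f : PolyS) : Prop :=
  ∃ d₁ d₂ : ℕ, IsFreeWithExponents f d₁ d₂

/-- An arrangement of `d` distinct lines in the complex projective plane, the `i`-th line being
`ℓᵢ = 0` with `ℓᵢ = (coeff i 0) x + (coeff i 1) y + (coeff i 2) z`. The forms are nonzero and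
no two of them are proportional. -/
structure LineArrangement (d : ℕ) where
  coeff : Fin d → Fin 3 → ℂ
  coeff_ne_zero : ∀ i, coeff i ≠ 0
  distinct : ∀ i j, i ≠ j → ∀ c : ℂ, coeff j ≠ c • coeff i

namespace LineArrangement

variable {d : ℕ}

/-- The linear form `ℓᵢ`. -/
noncomputable def linearForm (A : LineArrangement d) (i : Fin d) : PolyS :=
  ∑ j, MvPolynomial.C (A.coeff i j) * MvPolynomial.X j

/-- The defining polynomial `f = ℓ₁ ⋯ ℓ_d` of the arrangement. -/
noncomputable def poly (A : LineArrangement d) : PolyS :=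
  ∏ i, A.linearForm i

/-- The `i`-th line, as a plane through the origin in `ℂ³`. -/
def line (A : LineArrangement d) (i : Fin d) : Submodule ℂ (Fin 3 → ℂ) where
  carrier := {v | ∑ j, A.coeff i j * v j = 0}
  add_mem' := by
    intro v w hv hw
    simp only [Set.mem_ofPred_eq, Pi.add_apply, mul_add, Finset.sum_add_distrib] at *
    rw [hv, hw, add_zero]
  zero_mem' := by simp
  smul_mem' := by
    intro c v hv
    simp only [Set.mem_ofPred_eq, Pi.smul_apply, smul_eq_mul] at *
    simp only [mul_left_comm _ c, ← Finset.mul_sum, hv, mul_zero]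

/-- The intersection of the lines indexed by `I`; it is the whole space for `I = ∅`. -/
def flat (A : LineArrangement d) (I : Finset (Fin d)) : Submodule ℂ (Fin 3 → ℂ) :=
  ⨅ i ∈ I, A.line i

/-- The intersection lattice `L(𝒜)`: all intersections of lines of the arrangement, ordered by
reverse inclusion. -/
abbrev IntersectionLattice (A : LineArrangement d) : Type :=
  (↥(Set.range A.flat))ᵒᵈ

/-- The number of lines of the arrangement passing through the point `p` of the plane. -/
noncomputable def multiplicity (A : LineArrangement d)
    (p : Projectivization ℂ (Fin 3 → ℂ)) : ℕ :=
  {i : Fin d | p.submodule ≤ A.line i}.ncard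

theorem multiplicity_le (A : LineArrangement d) (p : Projectivization ℂ (Fin 3 → ℂ)) :
    A.multiplicity p ≤ d := by
  simpa [multiplicity] using Set.ncard_le_card {i : Fin d | p.submodule ≤ A.line i}

/-- The maximal multiplicity `m(𝒜)` of an intersection point, i.e. of a point on at least two
lines. The set is bounded by `d`; it is empty, and the value `0`, only when `d ≤ 1`. -/
noncomputable def maxMultiplicity (A : LineArrangement d) : ℕ :=
  sSup {m : ℕ | 2 ≤ m ∧ ∃ p, A.multiplicity p = m}

end LineArrangement

/-! Move a point of multiplicity `m ≥ d₁` to (0:0:1) and write `f = g h`, where `g` is the product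
of the lines through that point, a form in `x, y` only. Modulo the Euler field, a field tangent to
all the lines is `w (-g_y, g_x, 0) + c ∂_z`. So AR(f) becomes the module `pairs` of those `(w, c)`
tangent to the lines of `h` (`syzygyEquiv`). Homogeneous pairs whose determinant is a nonzero
constant times `h` form a basis, and every basis has such a determinant (`isFreeCurve_of_pairs`,
`cross_eq_of_basis`).

The first components `w` form an ideal given by local conditions. At each intersection point of
multiplicity `n` lying on no line of `g`, `w` must belong to `(t, ℓ ^ (n - 1))`, with `t` the join
of the point to (0:0:1) and `ℓ` a line of the arrangement through the point
(`exists_mem_pairs_of_local`, `exists_local_solution_of_mem_ideal`, `mem_ideal_of_mem_pairs`). In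
each degree this imposes at most `defect = Σ (n - 1)` conditions, a number determined by the lattice
and the chosen point.

Suppose the arrangement is free. If one basis element has a first component dividing the other, the
ideal is principal, hence everything, since first components have no common factor; then the defect
is 0. Otherwise the first generator has degree `d₁ + 1 - m ≤ 1`, so it is a linear form `ω` and `m =
d₁`. All the points then lie on `ω = 0`, and restricting the other generator to this line shows that
the defect is at most `e = d₂ + 1 - d₁` (`defect_of_isFreeWithExponents`).

Conversely, these numbers force freeness of any arrangement that has them. With defect 0 there is a
pair `(1, c)`, which together with `(0, h)` is a basis. With defect at most `e`, a dimension count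
for determinants against a pair of minimal degree produces a basis (`isFreeCurve_of_defect_le`). The
lattice determines which lines are concurrent, so the numbers pass from one arrangement to the
other. -/

open MvPolynomial

/-! ### Linear forms, linear substitutions and restriction to a line -/

/-- The linear form with the given coefficients. -/
noncomputable def linForm (a : Fin 3 → ℂ) : PolyS := ∑ j, C (a j) * X j

theorem linForm_add (a b : Fin 3 → ℂ) : linForm (a + b) = linForm a + linForm b := by
  simp [linForm, add_mul, Finset.sum_add_distrib]

theorem linForm_smul (c : ℂ) (a : Fin 3 → ℂ) : linForm (c • a) = C c * linForm a := by
  simp [linForm, mul_assoc, Finset.mul_sum]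

theorem linForm_single (i : Fin 3) : linForm (Pi.single i 1) = X i := by
  fin_cases i <;> simp [linForm, Fin.sum_univ_three]

theorem pderiv_linForm (i : Fin 3) (a : Fin 3 → ℂ) : pderiv i (linForm a) = C (a i) := by
  fin_cases i <;> simp [linForm, Fin.sum_univ_three, pderiv_X]

theorem linForm_isHomogeneous (a : Fin 3 → ℂ) : (linForm a).IsHomogeneous 1 :=
  IsHomogeneous.sum _ _ _ fun _ _ => isHomogeneous_C_mul_X _ _

theorem linForm_eq_zero {a : Fin 3 → ℂ} : linForm a = 0 ↔ a = 0 := by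
  constructor
  · intro h
    ext i
    have := pderiv_linForm i a
    rw [h, map_zero] at this
    simpa using this.symm
  · rintro rfl
    simp [linForm]

theorem eval_linForm (p a : Fin 3 → ℂ) : eval p (linForm a) = ∑ j, a j * p j := by
  simp [linForm]

theorem algHom_linForm (φ : PolyS →ₐ[ℂ] PolyS) (r : (Fin 3 → ℂ) →ₗ[ℂ] (Fin 3 → ℂ))
    (h : ∀ i, φ (X i) = linForm (r (Pi.single i 1))) (a : Fin 3 → ℂ) :
    φ (linForm a) = linForm (r a) := by
  have ha : a = ∑ i, a i • (Pi.single i 1 : Fin 3 → ℂ) := by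
    ext k; fin_cases k <;> simp [Fin.sum_univ_three]
  have hC : ∀ c, φ (C c) = C c := fun c => φ.commutes c
  conv_rhs => rw [ha]
  simp only [Fin.sum_univ_three, map_add, map_smul, linForm_add, linForm_smul]
  simp [linForm, Fin.sum_univ_three, hC, h]

/-- The substitution of variables induced by a linear endomorphism of the space of linear forms. -/
noncomputable def linSubst (r : (Fin 3 → ℂ) →ₗ[ℂ] (Fin 3 → ℂ)) : PolyS →ₐ[ℂ] PolyS :=
  aeval fun i => linForm (r (Pi.single i 1))

theorem linSubst_X (r : (Fin 3 → ℂ) →ₗ[ℂ] (Fin 3 → ℂ)) (i : Fin 3) :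
    linSubst r (X i) = linForm (r (Pi.single i 1)) := by
  simp [linSubst]

theorem linSubst_linForm (r : (Fin 3 → ℂ) →ₗ[ℂ] (Fin 3 → ℂ)) (a : Fin 3 → ℂ) :
    linSubst r (linForm a) = linForm (r a) :=
  algHom_linForm _ r (linSubst_X r) a

theorem linSubst_C (r : (Fin 3 → ℂ) →ₗ[ℂ] (Fin 3 → ℂ)) (c : ℂ) :
    linSubst r (C c) = C c := (linSubst r).commutes c

theorem linSubst_isHomogeneous (r : (Fin 3 → ℂ) →ₗ[ℂ] (Fin 3 → ℂ)) {p : PolyS} {k : ℕ}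
    (hp : p.IsHomogeneous k) : (linSubst r p).IsHomogeneous k := by
  have := hp.aeval (fun i => linForm (r (Pi.single i 1))) (fun i => linForm_isHomogeneous _)
  rwa [one_mul] at this

/-- An invertible linear change of variables. -/
noncomputable def linChange (N : (Fin 3 → ℂ) ≃ₗ[ℂ] (Fin 3 → ℂ)) : PolyS ≃ₐ[ℂ] PolyS :=
  AlgEquiv.ofAlgHom (linSubst N.toLinearMap) (linSubst N.symm.toLinearMap)
    (by
      ext1 i
      simp [linSubst_X, linSubst_linForm, linForm_single])
    (by
      ext1 i
      simp [linSubst_X, linSubst_linForm, linForm_single])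

theorem linChange_linForm (N : (Fin 3 → ℂ) ≃ₗ[ℂ] (Fin 3 → ℂ)) (a : Fin 3 → ℂ) :
    linChange N (linForm a) = linForm (N a) := linSubst_linForm _ a

theorem exists_linearEquiv_of_linearIndependent_pair {a b : Fin 3 → ℂ}
    (h : LinearIndependent ℂ ![a, b]) :
    ∃ N : (Fin 3 → ℂ) ≃ₗ[ℂ] (Fin 3 → ℂ), N a = Pi.single 0 1 ∧ N b = Pi.single 1 1 := by
  obtain ⟨c, hc⟩ := exists_linearIndependent_snoc_of_lt_finrank h (by simp)
  let B := basisOfLinearIndependentOfCardEqFinrank hc (by simp)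
  have hB : ∀ i, B i = (Fin.snoc ![a, b] c : Fin 3 → Fin 3 → ℂ) i := fun i => by
    simp [B]
  refine ⟨B.equivFun, ?_, ?_⟩
  · have : B 0 = a := hB 0
    rw [← this, B.equivFun_apply, B.repr_self]
    ext j; fin_cases j <;> simp
  · have : B 1 = b := hB 1
    rw [← this, B.equivFun_apply, B.repr_self]
    ext j; fin_cases j <;> simp

/-- A linear change of variables turns the form into a variable. -/
theorem linForm_prime {a : Fin 3 → ℂ} (ha : a ≠ 0) : Prime (linForm a) := by
  have ha' : LinearIndependent ℂ ![a] := by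
    rw [linearIndependent_unique_iff]
    simpa using ha
  obtain ⟨b, hb⟩ := exists_linearIndependent_snoc_of_lt_finrank ha' (by simp)
  have h2 : (Fin.snoc ![a] b : Fin 2 → Fin 3 → ℂ) = ![a, b] := by
    ext i j; fin_cases i <;> rfl
  rw [h2] at hb
  obtain ⟨N, hN, -⟩ := exists_linearEquiv_of_linearIndependent_pair hb
  rw [← MulEquiv.prime_iff (linChange N)]
  rw [linChange_linForm, hN, linForm_single]
  exact X_prime

/-- Restriction to the zero locus of a nonzero linear form, by elimination of a variable. -/
theorem exists_restriction {a : Fin 3 → ℂ} (ha : a ≠ 0) :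
    ∃ r : (Fin 3 → ℂ) →ₗ[ℂ] (Fin 3 → ℂ), (∀ b, ∃ c : ℂ, r b = b - c • a) ∧ r a = 0 ∧
      (∀ p, linSubst r p = 0 ↔ linForm a ∣ p) ∧
      (∀ b, r (r b) = r b) ∧ ∀ p, linSubst r (linSubst r p) = linSubst r p := by
  obtain ⟨k, hk⟩ : ∃ k, a k ≠ 0 := by
    by_contra! h
    exact ha (funext h)
  let r : (Fin 3 → ℂ) →ₗ[ℂ] (Fin 3 → ℂ) :=
    LinearMap.id - (LinearMap.proj k).smulRight ((a k)⁻¹ • a)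
  have hr : ∀ b, r b = b - (b k * (a k)⁻¹) • a := fun b => by simp [r, smul_smul]
  have hra : r a = 0 := by rw [hr, mul_inv_cancel₀ hk, one_smul, sub_self]
  have hidem : ∀ b, r (r b) = r b := by
    intro b
    conv_lhs => rw [hr b]
    rw [map_sub, map_smul, hra, smul_zero, sub_zero]
  refine ⟨r, fun b => ⟨_, hr b⟩, hra, fun p => ?_, hidem, fun p => ?_⟩
  swap
  · have : (linSubst r).comp (linSubst r) = linSubst r := by
      ext1 i
      simp [linSubst_X, linSubst_linForm, hidem]
    exact DFunLike.congr_fun this p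
  -- The substitution changes each variable by a multiple of `linForm a`, so it is the identity
  -- modulo that form.
  have hq : (Ideal.Quotient.mkₐ ℂ (Ideal.span {linForm a})).comp (linSubst r) =
      Ideal.Quotient.mkₐ ℂ (Ideal.span {linForm a}) := by
    ext1 i
    simp only [AlgHom.comp_apply, Ideal.Quotient.mkₐ_eq_mk]
    rw [Ideal.Quotient.eq, Ideal.mem_span_singleton, linSubst_X, hr,
      sub_eq_add_neg (Pi.single i 1), ← neg_smul, linForm_add, linForm_smul, linForm_single]
    exact ⟨C (-((Pi.single i 1 : Fin 3 → ℂ) k * (a k)⁻¹)), by ring⟩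
  have hp : linForm a ∣ linSubst r p - p := by
    have := DFunLike.congr_fun hq p
    simp only [AlgHom.comp_apply, Ideal.Quotient.mkₐ_eq_mk] at this
    rwa [Ideal.Quotient.eq, Ideal.mem_span_singleton] at this
  constructor
  · intro h
    rw [h, zero_sub] at hp
    exact (dvd_neg).1 hp
  · rintro ⟨q, rfl⟩
    rw [map_mul, linSubst_linForm, hra, linForm_eq_zero.2 rfl, zero_mul]

theorem linForm_dvd_linForm {a b : Fin 3 → ℂ} (ha : a ≠ 0) :
    linForm a ∣ linForm b ↔ ∃ c : ℂ, b = c • a := by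
  constructor
  · intro h
    obtain ⟨r, hr, hra, hrp, -⟩ := exists_restriction ha
    obtain ⟨c, hc⟩ := hr b
    have := (hrp _).2 h
    rw [linSubst_linForm, linForm_eq_zero, hc, sub_eq_zero] at this
    exact ⟨c, this⟩
  · rintro ⟨c, rfl⟩
    rw [linForm_smul]
    exact Dvd.intro_left _ rfl

theorem associated_linForm {a b : Fin 3 → ℂ} (ha : a ≠ 0) (hb : b ≠ 0) :
    Associated (linForm a) (linForm b) ↔ ∃ c : ℂ, b = c • a := by
  rw [← linForm_dvd_linForm ha]
  exact ⟨fun h => h.dvd, fun h => (linForm_prime ha).associated_of_dvd (linForm_prime hb) h⟩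

/-! ### Interpolation along lines -/

/-- Products over distinct associate classes are coprime, so divisibility may be checked one class
at a time; `t` is allowed to exceed the class. -/
theorem prod_dvd_of_associated_classes {ι R : Type*} [CommRing R] [IsDomain R]
    [UniqueFactorizationMonoid R] (s : Finset ι)
    (u : ι → R) (hu : ∀ i ∈ s, Prime (u i)) (x : R)
    (h : ∀ j ∈ s, ∃ t ⊆ s, (∀ i ∈ s, Associated (u j) (u i) → i ∈ t) ∧ ∏ i ∈ t, u i ∣ x) :
    ∏ i ∈ s, u i ∣ x := by
  classical
  rw [← Finset.prod_fiberwise_of_maps_to (t := s.image fun i => Associates.mk (u i))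
    (g := fun i => Associates.mk (u i)) (fun i hi => Finset.mem_image_of_mem _ hi)]
  apply Finset.prod_dvd_of_isRelPrime
  · intro c hc c' hc' hcc
    apply IsRelPrime.prod_left
    intro i hi
    apply IsRelPrime.prod_right
    intro j hj
    rw [Finset.mem_filter] at hi hj
    refine ((hu i hi.1).irreducible.isRelPrime_iff_not_dvd).2 fun hd => hcc ?_
    rw [← hi.2, ← hj.2, Associates.mk_eq_mk_iff_associated]
    exact (hu i hi.1).associated_of_dvd (hu j hj.1) hd
  · intro c hc
    obtain ⟨j, hj, rfl⟩ := Finset.mem_image.1 hc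
    obtain ⟨t, -, ht', htx⟩ := h j hj
    refine (Finset.prod_dvd_prod_of_subset _ _ _ ?_).trans htx
    intro i hi
    rw [Finset.mem_filter] at hi
    exact ht' i hi.1 (Associates.mk_eq_mk_iff_associated.1 hi.2.symm)

theorem prod_linForm_dvd {ι : Type*} (s : Finset ι) (v : ι → Fin 3 → ℂ)
    (hd : ∀ i ∈ s, v i ≠ 0) (hd' : ∀ i ∈ s, ∀ j ∈ s, i ≠ j → ∀ c : ℂ, v j ≠ c • v i) (x : PolyS)
    (h : ∀ i ∈ s, linForm (v i) ∣ x) : ∏ i ∈ s, linForm (v i) ∣ x := by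
  apply Finset.prod_dvd_of_isRelPrime
  · intro i hi j hj hij
    refine ((linForm_prime (hd i hi)).irreducible.isRelPrime_iff_not_dvd).2 fun h => ?_
    obtain ⟨c, hc⟩ := (linForm_dvd_linForm (hd i hi)).1 h
    exact hd' i hi j hj hij c hc
  · exact h

/-- Simultaneous interpolation along lines: it is enough to interpolate at every intersection
point. -/
theorem exists_interpolation {ι : Type*} (s : Finset ι) (v : ι → Fin 3 → ℂ)
    (hd : ∀ i ∈ s, v i ≠ 0) (hd' : ∀ i ∈ s, ∀ j ∈ s, i ≠ j → ∀ c : ℂ, v j ≠ c • v i)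
    (F : ι → PolyS)
    (h : ∀ i ∈ s, ∀ j ∈ s, i ≠ j → ∃ c, ∀ k ∈ s, v k ∈ Submodule.span ℂ {v i, v j} →
      linForm (v k) ∣ c - F k) :
    ∃ c, ∀ k ∈ s, linForm (v k) ∣ c - F k := by
  classical
  induction s using Finset.induction_on with
  | empty => exact ⟨0, by simp⟩
  | insert n s hn ih =>
    obtain ⟨c, hc⟩ := ih (fun i hi => hd i (Finset.mem_insert_of_mem hi))
      (fun i hi j hj => hd' i (Finset.mem_insert_of_mem hi) j (Finset.mem_insert_of_mem hj))
      (fun i hi j hj hij => (h i (Finset.mem_insert_of_mem hi) j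
        (Finset.mem_insert_of_mem hj) hij).imp fun c hc k hk => hc k (Finset.mem_insert_of_mem hk))
    have hns : n ∈ insert n s := Finset.mem_insert_self _ _
    obtain ⟨r, hr, hra, hrp, hidem, hidem'⟩ := exists_restriction (hd n hns)
    have hne : ∀ i ∈ s, n ≠ i := fun i hi h => hn (h ▸ hi)
    have hr0 : ∀ i ∈ s, r (v i) ≠ 0 := by
      intro i hi h0
      obtain ⟨c, hc⟩ := hr (v i)
      rw [h0, eq_comm, sub_eq_zero] at hc
      exact hd' n hns i (Finset.mem_insert_of_mem hi) (hne i hi) c hc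
    -- On the line `v n`, two other lines become associate only if they meet it at the same point.
    -- At such a point the local solution `c'` agrees with `F n` along the line, and `c' - c` is
    -- divisible by the product of the other lines through the point.
    have key : ∏ i ∈ s, linForm (r (v i)) ∣ linSubst r (F n - c) := by
      apply prod_dvd_of_associated_classes s _ fun i hi => linForm_prime (hr0 i hi)
      intro j hj
      refine ⟨s.filter fun i => v i ∈ Submodule.span ℂ {v n, v j}, Finset.filter_subset _ _,
        ?_, ?_⟩
      · intro i hi hij
        rw [associated_linForm (hr0 j hj) (hr0 i hi)] at hij
        obtain ⟨e, he⟩ := hij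
        obtain ⟨c₁, h₁⟩ := hr (v i)
        obtain ⟨c₂, h₂⟩ := hr (v j)
        rw [Finset.mem_filter, Submodule.mem_span_pair]
        refine ⟨hi, c₁ - e * c₂, e, ?_⟩
        rw [h₁, h₂, smul_sub, smul_smul, sub_eq_iff_eq_add] at he
        rw [he, sub_smul]
        abel
      · obtain ⟨c', hc'⟩ := h n hns j (Finset.mem_insert_of_mem hj) (hne j hj)
        have h1 : ∏ i ∈ s.filter (fun i => v i ∈ Submodule.span ℂ {v n, v j}), linForm (v i) ∣
            c' - c := by
          apply prod_linForm_dvd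
          · intro i hi
            exact hd i (Finset.mem_insert_of_mem (Finset.mem_filter.1 hi).1)
          · intro i hi k hk
            exact hd' i (Finset.mem_insert_of_mem (Finset.mem_filter.1 hi).1) k
              (Finset.mem_insert_of_mem (Finset.mem_filter.1 hk).1)
          · intro i hi
            rw [Finset.mem_filter] at hi
            have := dvd_sub (hc' i (Finset.mem_insert_of_mem hi.1) hi.2) (hc i hi.1)
            rwa [sub_sub_sub_cancel_right] at this
        have h2 := map_dvd (linSubst r) h1
        rw [map_prod] at h2
        simp only [linSubst_linForm] at h2
        have h3 := (hrp _).2 (hc' n hns (Submodule.subset_span (by simp)))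
        have h4 : linSubst r (F n - c) = linSubst r (c' - c) := by
          rw [map_sub, sub_eq_zero] at h3
          rw [map_sub, map_sub, h3]
        rwa [h4]
    obtain ⟨q, hq⟩ := key
    have hq' : linSubst r (F n - c) = (∏ i ∈ s, linForm (r (v i))) * linSubst r q := by
      rw [← hidem', hq, map_mul, map_prod]
      simp only [linSubst_linForm, hidem]
    -- A multiple of the product does not disturb the earlier lines, and `q` corrects the value on
    -- the new one.
    refine ⟨c + (∏ i ∈ s, linForm (v i)) * q, fun k hk => ?_⟩
    rcases Finset.mem_insert.1 hk with rfl | hk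
    · rw [← hrp]
      have e : c + (∏ i ∈ s, linForm (v i)) * q - F k =
          (∏ i ∈ s, linForm (v i)) * q - (F k - c) := by ring
      rw [e, map_sub, hq', map_mul, map_prod]
      simp only [linSubst_linForm, sub_self]
    · rw [add_sub_right_comm]
      exact dvd_add (hc k hk) ((Finset.dvd_prod_of_mem _ hk).mul_right q)
-- Homogeneous polynomials and the dimension of graded pieces
theorem homogeneousComponent_mul_of_isHomogeneous {p : PolyS} {a : ℕ} (hp : p.IsHomogeneous a)
    (k : ℕ) (q : PolyS) :
    homogeneousComponent (a + k) (p * q) = p * homogeneousComponent k q := by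
  conv_lhs => rw [← sum_homogeneousComponent q, Finset.mul_sum, map_sum]
  have h : ∀ i, homogeneousComponent (a + k) (p * homogeneousComponent i q) =
      if i = k then p * homogeneousComponent i q else 0 := by
    intro i
    rw [homogeneousComponent_of_mem (hp.mul (homogeneousComponent_isHomogeneous i q))]
    simp [eq_comm]
  simp only [h, Finset.sum_ite_eq', Finset.mem_range]
  split_ifs with hk
  · rfl
  · rw [homogeneousComponent_eq_zero _ _ (by omega), mul_zero]

theorem isHomogeneous_of_mul_left {p q : PolyS} {a k : ℕ} (hp : p.IsHomogeneous a) (h0 : p ≠ 0)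
    (h : (p * q).IsHomogeneous (a + k)) : q.IsHomogeneous k := by
  have h1 := homogeneousComponent_mul_of_isHomogeneous hp k q
  rw [homogeneousComponent_eq_self h] at h1
  rw [mul_left_cancel₀ h0 h1]
  exact homogeneousComponent_isHomogeneous _ _

theorem le_of_isHomogeneous_mul {p q : PolyS} {a b : ℕ} (hp : p.IsHomogeneous a)
    (h : (p * q).IsHomogeneous b) (h0 : p * q ≠ 0) : a ≤ b := by
  have h1 := h.totalDegree h0
  rw [totalDegree_mul_of_isDomain (left_ne_zero_of_mul h0) (right_ne_zero_of_mul h0),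
    hp.totalDegree (left_ne_zero_of_mul h0)] at h1
  omega

theorem exists_eq_C_of_isHomogeneous_zero {p : PolyS} (h : p.IsHomogeneous 0) : ∃ c, p = C c :=
  ⟨_, (totalDegree_eq_zero_iff_eq_C).1 ((totalDegree_zero_iff_isHomogeneous _).2 h)⟩

theorem exists_linForm_of_isHomogeneous_one {p : PolyS} (h : p.IsHomogeneous 1) :
    ∃ a, p = linForm a := by
  have : p ∈ homogeneousSubmodule (Fin 3) ℂ 1 := h
  rw [homogeneousSubmodule_one_eq_span_X, Submodule.mem_span_range_iff_exists_fun] at this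
  obtain ⟨c, rfl⟩ := this
  exact ⟨c, by simp [linForm, smul_eq_C_mul]⟩

instance finite_homogeneousSubmodule (k : ℕ) : Module.Finite ℂ (homogeneousSubmodule (Fin 3) ℂ k) :=
  Module.Finite.iff_fg.2 (homogeneousSubmodule_fg _ _ _)

/-- Stars and bars, doubled to avoid division. -/
theorem finrank_homogeneousSubmodule (k : ℕ) :
    2 * Module.finrank ℂ (homogeneousSubmodule (Fin 3) ℂ k) = (k + 1) * (k + 2) := by
  have h1 : Module.finrank ℂ (homogeneousSubmodule (Fin 3) ℂ k) =
      (Finset.univ.finsuppAntidiag k : Finset (Fin 3 →₀ ℕ)).card := by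
    rw [homogeneousSubmodule_eq_finsupp_supported]
    have hs : {d : Fin 3 →₀ ℕ | d.degree = k} =
        ((Finset.univ.finsuppAntidiag k : Finset (Fin 3 →₀ ℕ)) : Set (Fin 3 →₀ ℕ)) := by
      ext d
      simp [Finsupp.degree_eq_sum]
    rw [hs]
    refine (LinearEquiv.finrank_eq (AddMonoidAlgebra.supportedEquivFinsupp _)).trans ?_
    simp
  rw [h1, Finset.card_finsuppAntidiag_nat_eq_choose, Finset.card_univ, Fintype.card_fin,
    show 3 + k - 1 = k + 2 by omega, Nat.choose_symm_add, Nat.choose_two_right,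
    Nat.mul_div_cancel' (Nat.even_mul_pred_self _).two_dvd]
  simp
  ring

/-! ### Jacobian syzygies as tangent fields modulo the Euler field -/

namespace LineArrangement

theorem dvd_derivation_prod {ι : Type*} (s : Finset ι) (q : ι → PolyS)
    (D : Derivation ℂ PolyS PolyS) (h : ∀ i ∈ s, q i ∣ D (q i)) :
    ∏ i ∈ s, q i ∣ D (∏ i ∈ s, q i) := by
  classical
  induction s using Finset.induction_on with
  | empty => simp
  | insert n s hn ih =>
    rw [Finset.prod_insert hn, D.leibniz, smul_eq_mul, smul_eq_mul, mul_comm (∏ i ∈ s, q i) (D _)]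
    exact dvd_add (mul_dvd_mul_left _ (ih fun i hi => h i (Finset.mem_insert_of_mem hi)))
      (mul_dvd_mul_right (h n (Finset.mem_insert_self _ _)) _)

/-- The vector field with the given components. -/
noncomputable def vectorField (a : Fin 3 → PolyS) : Derivation ℂ PolyS PolyS :=
  ∑ i, a i • pderiv i

theorem vectorField_apply (a : Fin 3 → PolyS) (p : PolyS) :
    vectorField a p = a 0 * pderiv 0 p + a 1 * pderiv 1 p + a 2 * pderiv 2 p := by
  simp [vectorField, Fin.sum_univ_three]

theorem vectorField_linForm (a : Fin 3 → PolyS) (b : Fin 3 → ℂ) :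
    vectorField a (linForm b) = a 0 * C (b 0) + a 1 * C (b 1) + a 2 * C (b 2) := by
  simp only [vectorField_apply, pderiv_linForm]

theorem mem_jacobianSyzygies_iff_vectorField (f : PolyS) (a : Fin 3 → PolyS) :
    a ∈ jacobianSyzygies f ↔ vectorField a f = 0 := by
  rw [mem_jacobianSyzygies, vectorField_apply, Fin.sum_univ_three]

variable {d : ℕ} (A : LineArrangement d)

open Classical in
/-- The indices of the lines through the point `(0 : 0 : 1)`. -/
noncomputable def pencil : Finset (Fin d) := Finset.univ.filter fun i => A.coeff i 2 = 0

theorem mem_pencil {i : Fin d} : i ∈ A.pencil ↔ A.coeff i 2 = 0 := by simp [pencil]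

/-- The product of the lines through `(0 : 0 : 1)`. -/
noncomputable def pencilPoly : PolyS := ∏ i ∈ A.pencil, linForm (A.coeff i)

/-- The product of the lines not through `(0 : 0 : 1)`. -/
noncomputable def restPoly : PolyS := ∏ i ∈ A.pencilᶜ, linForm (A.coeff i)

theorem poly_eq : A.poly = A.pencilPoly * A.restPoly := by
  rw [pencilPoly, restPoly, Finset.prod_mul_prod_compl]
  rfl

theorem pencilPoly_ne_zero : A.pencilPoly ≠ 0 :=
  Finset.prod_ne_zero_iff.2 fun i _ => (linForm_prime (A.coeff_ne_zero i)).ne_zero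

theorem restPoly_ne_zero : A.restPoly ≠ 0 :=
  Finset.prod_ne_zero_iff.2 fun i _ => (linForm_prime (A.coeff_ne_zero i)).ne_zero

theorem prod_linForm_isHomogeneous (s : Finset (Fin d)) :
    (∏ i ∈ s, linForm (A.coeff i)).IsHomogeneous s.card := by
  have := IsHomogeneous.prod s (fun i => linForm (A.coeff i)) (fun _ => 1)
    fun i _ => linForm_isHomogeneous _
  simpa using this

theorem pencilPoly_isHomogeneous : A.pencilPoly.IsHomogeneous A.pencil.card :=
  A.prod_linForm_isHomogeneous _

theorem restPoly_isHomogeneous : A.restPoly.IsHomogeneous A.pencilᶜ.card :=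
  A.prod_linForm_isHomogeneous _

theorem card_pencil_add : A.pencil.card + A.pencilᶜ.card = d := by
  rw [Finset.card_add_card_compl, Fintype.card_fin]

theorem pderiv_two_pencilPoly : pderiv 2 A.pencilPoly = 0 := by
  rw [pencilPoly]
  refine Finset.prod_induction _ (fun q => pderiv 2 q = 0) ?_ ?_ ?_
  · intro p q hp hq
    rw [pderiv_mul, hp, hq]; ring
  · simp
  · intro i hi
    rw [pderiv_linForm, A.mem_pencil.1 hi, map_zero]

theorem euler_pencilPoly :
    X 0 * pderiv 0 A.pencilPoly + X 1 * pderiv 1 A.pencilPoly =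
      C (A.pencil.card : ℂ) * A.pencilPoly := by
  have := A.pencilPoly_isHomogeneous.sum_X_mul_pderiv
  rw [Fin.sum_univ_three, A.pderiv_two_pencilPoly] at this
  simpa using this

theorem euler_restPoly :
    X 0 * pderiv 0 A.restPoly + X 1 * pderiv 1 A.restPoly + X 2 * pderiv 2 A.restPoly =
      C (A.pencilᶜ.card : ℂ) * A.restPoly := by
  have := A.restPoly_isHomogeneous.sum_X_mul_pderiv
  rw [Fin.sum_univ_three] at this
  simpa using this

theorem C_card_add : (C (A.pencil.card : ℂ) + C (A.pencilᶜ.card : ℂ) : PolyS) = C (d : ℂ) := by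
  rw [← C_add, ← Nat.cast_add, A.card_pencil_add]

/-- The value on a linear form of the vector field `(-g_y, g_x, 0)`, where `g` is the product of
the lines through `(0 : 0 : 1)`. -/
noncomputable def chi (a : Fin 3 → ℂ) : PolyS :=
  C (a 1) * pderiv 0 A.pencilPoly - C (a 0) * pderiv 1 A.pencilPoly

/-- The pairs `(w, c)` such that `w (-g_y, g_x, 0) + c (0, 0, 1)` is tangent to all lines of the
arrangement. -/
noncomputable def pairs : Submodule PolyS (PolyS × PolyS) where
  carrier := {x | ∀ i ∉ A.pencil,
    linForm (A.coeff i) ∣ x.1 * A.chi (A.coeff i) + C (A.coeff i 2) * x.2}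
  add_mem' := by
    intro x y hx hy i hi
    have := dvd_add (hx i hi) (hy i hi)
    convert this using 1
    simp only [Prod.fst_add, Prod.snd_add]; ring
  zero_mem' := by intro i hi; simp
  smul_mem' := by
    intro r x hx i hi
    have := (hx i hi).mul_left r
    convert this using 1
    simp only [Prod.smul_fst, Prod.smul_snd, smul_eq_mul]; ring

/-- The vector field `w (-g_y, g_x, 0) + c (0, 0, 1)`. -/
noncomputable def field (x : PolyS × PolyS) : Fin 3 → PolyS :=
  ![-(x.1 * pderiv 1 A.pencilPoly), x.1 * pderiv 0 A.pencilPoly, x.2]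

theorem vectorField_field (x : PolyS × PolyS) (p : PolyS) :
    vectorField (A.field x) p = -(x.1 * pderiv 1 A.pencilPoly) * pderiv 0 p +
      x.1 * pderiv 0 A.pencilPoly * pderiv 1 p + x.2 * pderiv 2 p := by
  rw [vectorField_apply]; rfl

theorem vectorField_field_linForm (x : PolyS × PolyS) (a : Fin 3 → ℂ) :
    vectorField (A.field x) (linForm a) = x.1 * A.chi a + C (a 2) * x.2 := by
  rw [vectorField_field, chi]
  simp only [pderiv_linForm]
  ring

/-- The field kills `pencilPoly`, so it multiplies the defining polynomial by `d * u`, exactly as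
`u` times the Euler field does. This is why the factor `d` is split off. -/
theorem exists_mul_restPoly {x : PolyS × PolyS} (hx : x ∈ A.pairs) (hd : d ≠ 0) :
    ∃ u, vectorField (A.field x) A.restPoly = C (d : ℂ) * A.restPoly * u := by
  have h : A.restPoly ∣ vectorField (A.field x) A.restPoly := by
    apply dvd_derivation_prod
    intro i hi
    rw [vectorField_field_linForm]
    exact hx i (Finset.mem_compl.1 hi)
  obtain ⟨v, hv⟩ := h
  refine ⟨C ((d : ℂ)⁻¹) * v, ?_⟩
  have : (C (d : ℂ) * C ((d : ℂ)⁻¹) : PolyS) = 1 := by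
    rw [← C_mul, mul_inv_cancel₀ (Nat.cast_ne_zero.2 hd), C_1]
  rw [hv]
  linear_combination (-(A.restPoly * v)) * this

theorem C_mul_restPoly_ne_zero (hd : d ≠ 0) : C (d : ℂ) * A.restPoly ≠ 0 :=
  mul_ne_zero (by simpa using hd) A.restPoly_ne_zero

/-- The multiple of the Euler field to be subtracted in order to get a syzygy. -/
noncomputable def eulerCoeff (hd : d ≠ 0) (x : A.pairs) : PolyS :=
  (A.exists_mul_restPoly x.2 hd).choose

theorem eulerCoeff_spec (hd : d ≠ 0) (x : A.pairs) :
    vectorField (A.field x) A.restPoly = C (d : ℂ) * A.restPoly * A.eulerCoeff hd x :=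
  (A.exists_mul_restPoly x.2 hd).choose_spec

/-- The Jacobian syzygy of a pair. -/
noncomputable def syzygyFun (hd : d ≠ 0) (x : A.pairs) : Fin 3 → PolyS :=
  ![A.field x 0 - A.eulerCoeff hd x * X 0, A.field x 1 - A.eulerCoeff hd x * X 1,
    A.field x 2 - A.eulerCoeff hd x * X 2]

theorem syzygyFun_zero (hd : d ≠ 0) (x : A.pairs) : A.syzygyFun hd x 0 =
    -(x.1.1 * pderiv 1 A.pencilPoly) - A.eulerCoeff hd x * X 0 := rfl

theorem syzygyFun_one (hd : d ≠ 0) (x : A.pairs) : A.syzygyFun hd x 1 =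
    x.1.1 * pderiv 0 A.pencilPoly - A.eulerCoeff hd x * X 1 := rfl

theorem syzygyFun_two (hd : d ≠ 0) (x : A.pairs) : A.syzygyFun hd x 2 =
    x.1.2 - A.eulerCoeff hd x * X 2 := rfl

theorem syzygyFun_mem (hd : d ≠ 0) (x : A.pairs) :
    A.syzygyFun hd x ∈ jacobianSyzygies A.poly := by
  rw [mem_jacobianSyzygies_iff_vectorField, vectorField_apply, syzygyFun_zero, syzygyFun_one,
    syzygyFun_two, poly_eq]
  simp only [pderiv_mul, pderiv_two_pencilPoly]
  have h1 := A.eulerCoeff_spec hd x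
  rw [vectorField_field, ← C_card_add] at h1
  linear_combination A.pencilPoly * h1 - A.eulerCoeff hd x * A.restPoly * A.euler_pencilPoly -
    A.eulerCoeff hd x * A.pencilPoly * A.euler_restPoly

/-- The linear map from pairs to Jacobian syzygies. -/
noncomputable def syzygyMap (hd : d ≠ 0) : A.pairs →ₗ[PolyS] jacobianSyzygies A.poly where
  toFun x := ⟨A.syzygyFun hd x, A.syzygyFun_mem hd x⟩
  map_add' := by
    intro x y
    have h : A.eulerCoeff hd (x + y) = A.eulerCoeff hd x + A.eulerCoeff hd y := by
      apply mul_left_cancel₀ (A.C_mul_restPoly_ne_zero hd)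
      rw [← eulerCoeff_spec, mul_add, ← eulerCoeff_spec, ← eulerCoeff_spec]
      simp only [vectorField_field, Submodule.coe_add, Prod.fst_add, Prod.snd_add]
      ring
    ext1
    funext i
    fin_cases i <;> simp [syzygyFun, field, h] <;> ring
  map_smul' := by
    intro r x
    have h : A.eulerCoeff hd (r • x) = r * A.eulerCoeff hd x := by
      apply mul_left_cancel₀ (A.C_mul_restPoly_ne_zero hd)
      rw [← eulerCoeff_spec, mul_left_comm, ← eulerCoeff_spec]
      simp only [vectorField_field, Submodule.coe_smul, Prod.smul_fst, Prod.smul_snd, smul_eq_mul]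
      ring
    ext1
    funext i
    fin_cases i <;> simp [syzygyFun, field, h] <;> ring

theorem syzygyMap_apply (hd : d ≠ 0) (x : A.pairs) :
    (A.syzygyMap hd x : Fin 3 → PolyS) = A.syzygyFun hd x := rfl

/-- This contraction annihilates the Euler field, so it recovers `w` from the syzygy. -/
theorem X_mul_syzygyFun_sub (hd : d ≠ 0) (x : A.pairs) :
    X 0 * A.syzygyFun hd x 1 - X 1 * A.syzygyFun hd x 0 =
      C (A.pencil.card : ℂ) * A.pencilPoly * x.1.1 := by
  rw [syzygyFun_zero, syzygyFun_one]
  linear_combination x.1.1 * A.euler_pencilPoly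

theorem C_mul_pencilPoly_ne_zero (hm : A.pencil.card ≠ 0) :
    C (A.pencil.card : ℂ) * A.pencilPoly ≠ 0 :=
  mul_ne_zero (by simpa using hm) A.pencilPoly_ne_zero

theorem syzygyMap_injective (hd : d ≠ 0) (hm : A.pencil.card ≠ 0) :
    Function.Injective (A.syzygyMap hd) := by
  rw [injective_iff_map_eq_zero]
  intro x hx
  have h0 : A.syzygyFun hd x = 0 := congrArg Subtype.val hx
  have h1 := A.X_mul_syzygyFun_sub hd x
  rw [h0, Pi.zero_apply, Pi.zero_apply, mul_zero, mul_zero, sub_zero, eq_comm,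
    mul_eq_zero, or_iff_right (A.C_mul_pencilPoly_ne_zero hm)] at h1
  have h2 := A.syzygyFun_zero hd x
  have h3 := A.syzygyFun_two hd x
  rw [h0, h1] at h2
  rw [h0] at h3
  have h4 : A.eulerCoeff hd x = 0 := by
    simpa [X_ne_zero] using h2
  rw [h4] at h3
  have h5 : x.1.2 = 0 := by simpa using h3.symm
  exact Subtype.ext (Prod.ext h1 h5)

/-- By the Leibniz rule the line divides its own derivative times the product of the other lines, to
which it is coprime. -/
theorem linForm_dvd_vectorField {a : Fin 3 → PolyS} (ha : a ∈ jacobianSyzygies A.poly)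
    (i : Fin d) : linForm (A.coeff i) ∣ vectorField a (linForm (A.coeff i)) := by
  classical
  rw [mem_jacobianSyzygies_iff_vectorField] at ha
  have hp : A.poly = linForm (A.coeff i) * ∏ j ∈ Finset.univ.erase i, linForm (A.coeff j) :=
    (Finset.mul_prod_erase _ _ (Finset.mem_univ i)).symm
  rw [hp, Derivation.leibniz, smul_eq_mul, smul_eq_mul] at ha
  have h1 : linForm (A.coeff i) ∣ (∏ j ∈ Finset.univ.erase i, linForm (A.coeff j)) *
      vectorField a (linForm (A.coeff i)) := by
    rw [eq_neg_of_add_eq_zero_right ha]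
    exact (Dvd.intro _ rfl).neg_right
  have hpr := linForm_prime (A.coeff_ne_zero i)
  refine (hpr.dvd_or_dvd h1).resolve_left fun h2 => ?_
  obtain ⟨j, hj, hij⟩ := (Prime.dvd_finsetProd_iff hpr _).1 h2
  obtain ⟨c, hc⟩ := (linForm_dvd_linForm (A.coeff_ne_zero i)).1 hij
  exact A.distinct i j (Finset.ne_of_mem_erase hj).symm c hc

theorem prod_linForm_dvd' (s : Finset (Fin d)) (x : PolyS)
    (h : ∀ i ∈ s, linForm (A.coeff i) ∣ x) : ∏ i ∈ s, linForm (A.coeff i) ∣ x :=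
  prod_linForm_dvd s _ (fun i _ => A.coeff_ne_zero i)
    (fun i _ j _ hij => A.distinct i j hij) x h

/-- Tangency to the lines through (0:0:1) makes `X 0 * a 1 - X 1 * a 0` divisible by `pencilPoly`;
the quotient over `m` is `w`. What remains of `(a 0, a 1)` is proportional to `(X 0, X 1)`, hence
comes from a multiple `u` of the Euler field. -/
theorem syzygyMap_surjective (hd : d ≠ 0) (hm : A.pencil.card ≠ 0) :
    Function.Surjective (A.syzygyMap hd) := by
  rintro ⟨a, ha⟩
  have hl := A.linForm_dvd_vectorField ha
  have hg : A.pencilPoly ∣ X 0 * a 1 - X 1 * a 0 := by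
    apply prod_linForm_dvd'
    intro i hi
    have h2 : A.coeff i 2 = 0 := A.mem_pencil.1 hi
    obtain ⟨s, hs⟩ := hl i
    rw [vectorField_linForm, h2] at hs
    have hL : linForm (A.coeff i) = C (A.coeff i 0) * X 0 + C (A.coeff i 1) * X 1 := by
      simp [linForm, Fin.sum_univ_three, h2]
    by_cases h1 : A.coeff i 1 = 0
    · have h0 : A.coeff i 0 ≠ 0 := by
        intro h0
        refine A.coeff_ne_zero i (funext fun k => ?_)
        fin_cases k <;> assumption
      have hu : IsUnit (C (A.coeff i 0) : PolyS) := (IsUnit.mk0 _ h0).map C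
      rw [← hu.dvd_mul_left]
      refine ⟨a 1 - X 1 * s, ?_⟩
      rw [hL] at hs ⊢
      rw [C_0] at hs
      linear_combination (-X 1) * hs
    · have hu : IsUnit (C (A.coeff i 1) : PolyS) := (IsUnit.mk0 _ h1).map C
      rw [← hu.dvd_mul_left]
      refine ⟨X 0 * s - a 0, ?_⟩
      rw [hL] at hs ⊢
      rw [C_0] at hs
      linear_combination (X 0) * hs
  obtain ⟨v, hv⟩ := hg
  have hC : (C (A.pencil.card : ℂ) * C ((A.pencil.card : ℂ)⁻¹) : PolyS) = 1 := by
    rw [← C_mul, mul_inv_cancel₀ (Nat.cast_ne_zero.2 hm), C_1]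
  set w : PolyS := C ((A.pencil.card : ℂ)⁻¹) * v with hw
  have hx : X 0 * (a 1 - w * pderiv 0 A.pencilPoly) =
      X 1 * (a 0 + w * pderiv 1 A.pencilPoly) := by
    linear_combination hv - w * A.euler_pencilPoly - A.pencilPoly * v * hC
  have h01 : ¬ (X 0 : PolyS) ∣ X 1 := by
    rw [X_dvd_X]; simp
  obtain ⟨u, hu⟩ : (X 0 : PolyS) ∣ a 0 + w * pderiv 1 A.pencilPoly :=
    (X_prime.dvd_or_dvd (Dvd.intro _ hx)).resolve_left h01
  have hu1 : a 1 - w * pderiv 0 A.pencilPoly = X 1 * u := by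
    apply mul_left_cancel₀ (X_ne_zero (0 : Fin 3) : (X 0 : PolyS) ≠ 0)
    rw [hx, hu]; ring
  have hpair : (w, a 2 - u * X 2) ∈ A.pairs := by
    intro i _
    obtain ⟨s, hs⟩ := hl i
    refine ⟨s - u, ?_⟩
    rw [vectorField_linForm] at hs
    have hL : linForm (A.coeff i) = C (A.coeff i 0) * X 0 + C (A.coeff i 1) * X 1 +
        C (A.coeff i 2) * X 2 := by
      simp [linForm, Fin.sum_univ_three]
    simp only [chi]
    rw [hL] at hs ⊢
    linear_combination hs - C (A.coeff i 1) * hu1 - C (A.coeff i 0) * hu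
  refine ⟨⟨_, hpair⟩, ?_⟩
  -- The Euler coefficient is determined by the action on `restPoly`; the syzygy equation identifies
  -- it.
  have he : A.eulerCoeff hd ⟨_, hpair⟩ = -u := by
    apply mul_left_cancel₀ (A.C_mul_restPoly_ne_zero hd)
    apply mul_left_cancel₀ A.pencilPoly_ne_zero
    rw [← eulerCoeff_spec, vectorField_field]
    rw [mem_jacobianSyzygies_iff_vectorField, vectorField_apply, poly_eq] at ha
    simp only [pderiv_mul, pderiv_two_pencilPoly] at ha
    have := A.C_card_add
    linear_combination ha - A.pencilPoly * A.restPoly * u * this -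
      (A.restPoly * pderiv 0 A.pencilPoly + A.pencilPoly * pderiv 0 A.restPoly) * hu -
      (A.restPoly * pderiv 1 A.pencilPoly + A.pencilPoly * pderiv 1 A.restPoly) * hu1 -
      u * A.restPoly * A.euler_pencilPoly - u * A.pencilPoly * A.euler_restPoly
  apply Subtype.ext
  rw [syzygyMap_apply]
  funext i
  fin_cases i
  · simp only [Fin.zero_eta, syzygyFun_zero, he]
    linear_combination -hu
  · simp only [Fin.mk_one, syzygyFun_one, he]
    linear_combination -hu1
  · simp only [Fin.reduceFinMk, syzygyFun_two, he]
    ring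

/-- Pairs correspond to Jacobian syzygies. -/
noncomputable def syzygyEquiv (hd : d ≠ 0) (hm : A.pencil.card ≠ 0) :
    A.pairs ≃ₗ[PolyS] jacobianSyzygies A.poly :=
  LinearEquiv.ofBijective (A.syzygyMap hd)
    ⟨A.syzygyMap_injective hd hm, A.syzygyMap_surjective hd hm⟩

theorem syzygyEquiv_apply (hd : d ≠ 0) (hm : A.pencil.card ≠ 0) (x : A.pairs) :
    (A.syzygyEquiv hd hm x : Fin 3 → PolyS) = A.syzygyFun hd x := rfl

/-! ### Saito's criterion and degrees for pairs -/

/-- Combining the two tangency conditions for a line cancels `chi` and leaves the determinant times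
the nonzero third coefficient. -/
theorem restPoly_dvd_cross {x y : PolyS × PolyS} (hx : x ∈ A.pairs) (hy : y ∈ A.pairs) :
    A.restPoly ∣ x.1 * y.2 - y.1 * x.2 := by
  apply prod_linForm_dvd'
  intro i hi
  rw [Finset.mem_compl] at hi
  have hu : IsUnit (C (A.coeff i 2) : PolyS) :=
    (IsUnit.mk0 _ fun h => hi (A.mem_pencil.2 h)).map C
  rw [← hu.dvd_mul_left]
  have := dvd_sub ((hy i hi).mul_left x.1) ((hx i hi).mul_left y.1)
  convert this using 1
  ring

/-- A pair is homogeneous of degree `D` when the vector field it defines is. -/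
def IsHomogeneousPair (x : PolyS × PolyS) (D : ℕ) : Prop :=
  (x.1 = 0 ∨ ∃ k, x.1.IsHomogeneous k ∧ k + A.pencil.card = D + 1) ∧ x.2.IsHomogeneous D

theorem fst_mul_pderiv_isHomogeneous {x : PolyS × PolyS} {D : ℕ} (hx : A.IsHomogeneousPair x D)
    (hm : A.pencil.card ≠ 0) (i : Fin 3) : (x.1 * pderiv i A.pencilPoly).IsHomogeneous D := by
  rcases hx.1 with h | ⟨k, hk, hkD⟩
  · rw [h, zero_mul]; exact isHomogeneous_zero _ _ _
  · have := hk.mul (A.pencilPoly_isHomogeneous.pderiv (i := i))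
    rwa [show k + (A.pencil.card - 1) = D by omega] at this

/-- The coefficient itself has degree `D - 1`; multiplying by a variable avoids a separate statement
for `D = 0`, where it vanishes. -/
theorem isHomogeneous_mul_eulerCoeff (hd : d ≠ 0) (hm : A.pencil.card ≠ 0) {x : A.pairs} {D : ℕ}
    (hx : A.IsHomogeneousPair x D) (i : Fin 3) :
    (A.eulerCoeff hd x * X i).IsHomogeneous D := by
  by_cases h0 : A.eulerCoeff hd x = 0
  · rw [h0, zero_mul]; exact isHomogeneous_zero _ _ _
  have hspec := A.eulerCoeff_spec hd x
  have hne : C (d : ℂ) * A.restPoly * A.eulerCoeff hd x ≠ 0 :=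
    mul_ne_zero (A.C_mul_restPoly_ne_zero hd) h0
  have hh : (C (d : ℂ) * A.restPoly).IsHomogeneous A.pencilᶜ.card :=
    A.restPoly_isHomogeneous.C_mul _
  have hhom : (vectorField (A.field x) A.restPoly).IsHomogeneous (D + (A.pencilᶜ.card - 1)) := by
    rw [vectorField_field]
    have hr := fun i => A.restPoly_isHomogeneous.pderiv (i := i)
    exact (((A.fst_mul_pderiv_isHomogeneous hx hm 1).neg.mul (hr 0)).add
      ((A.fst_mul_pderiv_isHomogeneous hx hm 0).mul (hr 1))).add (hx.2.mul (hr 2))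
  have hn : A.pencilᶜ.card ≠ 0 := by
    intro hn
    rw [Finset.card_eq_zero] at hn
    rw [← hspec] at hne
    apply hne
    rw [restPoly, hn, Finset.prod_empty, Derivation.map_one_eq_zero]
  rw [hspec] at hhom
  have hle := le_of_isHomogeneous_mul hh hhom hne
  obtain ⟨D, rfl⟩ : ∃ D', D = D' + 1 := ⟨D - 1, by omega⟩
  refine (isHomogeneous_of_mul_left hh (A.C_mul_restPoly_ne_zero hd) ?_).mul (isHomogeneous_X _ _)
  convert hhom using 1
  omega

theorem syzygyFun_isHomogeneous (hd : d ≠ 0) (hm : A.pencil.card ≠ 0) {x : A.pairs} {D : ℕ}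
    (hx : A.IsHomogeneousPair x D) (i : Fin 3) : (A.syzygyFun hd x i).IsHomogeneous D := by
  have h := A.isHomogeneous_mul_eulerCoeff hd hm hx
  fin_cases i
  · exact (A.fst_mul_pderiv_isHomogeneous hx hm 1).neg.sub (h 0)
  · exact (A.fst_mul_pderiv_isHomogeneous hx hm 0).sub (h 1)
  · exact hx.2.sub (h 2)

/-- Cramer's rule: determinants against either generator are divisible by `restPoly`, which is the
determinant of the generators up to a constant, so coordinates are polynomials. -/
theorem isFreeCurve_of_pairs_of_le (hm : A.pencil.card ≠ 0) {x y : PolyS × PolyS}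
    (hx : x ∈ A.pairs) (hy : y ∈ A.pairs) {D E : ℕ} (hxD : A.IsHomogeneousPair x D)
    (hyE : A.IsHomogeneousPair y E) {κ : ℂ} (hκ : κ ≠ 0)
    (h : x.1 * y.2 - y.1 * x.2 = C κ * A.restPoly) (hDE : D ≤ E) : IsFreeCurve A.poly := by
  have hd : d ≠ 0 := by
    have := A.card_pencil_add
    omega
  have hne : x.1 * y.2 - y.1 * x.2 ≠ 0 := by
    rw [h]
    exact mul_ne_zero (by simpa using hκ) A.restPoly_ne_zero
  let v : Fin 2 → A.pairs := ![⟨x, hx⟩, ⟨y, hy⟩]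
  have hli : LinearIndependent PolyS v := by
    rw [LinearIndependent.pair_iff]
    intro s t hst
    have h1 : s * x.1 + t * y.1 = 0 := congrArg (fun z : A.pairs => z.1.1) hst
    have h2 : s * x.2 + t * y.2 = 0 := congrArg (fun z : A.pairs => z.1.2) hst
    constructor
    · apply mul_right_cancel₀ hne
      linear_combination y.2 * h1 - y.1 * h2
    · apply mul_right_cancel₀ hne
      linear_combination x.1 * h2 - x.2 * h1
  have hC : (C κ * C κ⁻¹ : PolyS) = 1 := by
    rw [← C_mul, mul_inv_cancel₀ hκ, C_1]
  have hsp : ⊤ ≤ Submodule.span PolyS (Set.range v) := by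
    rintro ⟨z, hz⟩ -
    obtain ⟨r, hr⟩ := A.restPoly_dvd_cross hz hy
    obtain ⟨s, hs⟩ := A.restPoly_dvd_cross hx hz
    have hrange : Set.range v = {⟨x, hx⟩, ⟨y, hy⟩} := by simp [v, Set.pair_comm]
    rw [hrange, Submodule.mem_span_pair]
    refine ⟨C κ⁻¹ * r, C κ⁻¹ * s, ?_⟩
    apply Subtype.ext
    have hκh : C κ * A.restPoly ≠ 0 := h ▸ hne
    refine Prod.ext ?_ ?_
    · change C κ⁻¹ * r * x.1 + C κ⁻¹ * s * y.1 = z.1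
      apply mul_left_cancel₀ hκh
      linear_combination A.restPoly * (r * x.1 + s * y.1) * hC - x.1 * hr - y.1 * hs + z.1 * h
    · change C κ⁻¹ * r * x.2 + C κ⁻¹ * s * y.2 = z.2
      apply mul_left_cancel₀ hκh
      linear_combination A.restPoly * (r * x.2 + s * y.2) * hC - x.2 * hr - y.2 * hs + z.2 * h
  refine ⟨D, E, hDE, (Module.Basis.mk hli hsp).map (A.syzygyEquiv hd hm), ?_⟩
  intro j i
  rw [Module.Basis.map_apply, Module.Basis.mk_apply, syzygyEquiv_apply]
  fin_cases j
  · exact A.syzygyFun_isHomogeneous hd hm hxD i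
  · exact A.syzygyFun_isHomogeneous hd hm hyE i

/-- Saito's criterion, in terms of pairs. -/
theorem isFreeCurve_of_pairs (hm : A.pencil.card ≠ 0) {x y : PolyS × PolyS}
    (hx : x ∈ A.pairs) (hy : y ∈ A.pairs) {D E : ℕ} (hxD : A.IsHomogeneousPair x D)
    (hyE : A.IsHomogeneousPair y E) {κ : ℂ} (hκ : κ ≠ 0)
    (h : x.1 * y.2 - y.1 * x.2 = C κ * A.restPoly) : IsFreeCurve A.poly := by
  rcases le_total D E with hDE | hDE
  · exact A.isFreeCurve_of_pairs_of_le hm hx hy hxD hyE hκ h hDE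
  · refine A.isFreeCurve_of_pairs_of_le hm hy hx hyE hxD (neg_ne_zero.2 hκ) ?_ hDE
    rw [C_neg]
    linear_combination -h

theorem zero_restPoly_mem_pairs : (0, A.restPoly) ∈ A.pairs := by
  intro i hi
  refine dvd_add (by simp) (Dvd.dvd.mul_left ?_ _)
  exact Finset.dvd_prod_of_mem (fun i => linForm (A.coeff i)) (Finset.mem_compl.2 hi)

theorem restPoly_zero_mem_pairs : (A.restPoly, 0) ∈ A.pairs := by
  intro i hi
  refine dvd_add (Dvd.dvd.mul_right ?_ _) (by simp)
  exact Finset.dvd_prod_of_mem (fun i => linForm (A.coeff i)) (Finset.mem_compl.2 hi)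

open Classical in
-- The two terms of the condition on line `i` cancel; the other lines divide the product. Up to a
-- unit the first component is `restPoly` without line `i`, as needed to exclude common factors.
theorem erase_mem_pairs {i : Fin d} (hi : i ∉ A.pencil) :
    (C (A.coeff i 2) * ∏ j ∈ A.pencilᶜ.erase i, linForm (A.coeff j),
      -(A.chi (A.coeff i) * ∏ j ∈ A.pencilᶜ.erase i, linForm (A.coeff j))) ∈ A.pairs := by
  intro k hk
  by_cases hki : k = i
  · subst hki
    convert dvd_zero _ using 1
    ring
  · have : linForm (A.coeff k) ∣ ∏ j ∈ A.pencilᶜ.erase i, linForm (A.coeff j) :=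
      Finset.dvd_prod_of_mem (fun i => linForm (A.coeff i))
        (Finset.mem_erase.2 ⟨hki, Finset.mem_compl.2 hk⟩)
    exact dvd_add ((this.mul_left _).mul_right _) ((this.mul_left _).neg_right.mul_left _)

open Classical in
-- A prime factor would be associate to some line of `restPoly`, yet divide the product of the
-- others.
theorem isUnit_of_dvd_restPoly {v : PolyS} (hv : v ∣ A.restPoly)
    (h : ∀ i ∉ A.pencil, v ∣ ∏ j ∈ A.pencilᶜ.erase i, linForm (A.coeff j)) : IsUnit v := by
  by_contra hu
  have hv0 : v ≠ 0 := fun h0 => A.restPoly_ne_zero (zero_dvd_iff.1 (h0 ▸ hv))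
  obtain ⟨q, hq, hqv⟩ := WfDvdMonoid.exists_irreducible_factor hu hv0
  obtain ⟨i, hi, hqi⟩ := (Prime.dvd_finsetProd_iff hq.prime _).1 (hqv.trans hv)
  obtain ⟨j, hj, hqj⟩ := (Prime.dvd_finsetProd_iff hq.prime _).1
    (hqv.trans (h i (Finset.mem_compl.1 hi)))
  have h1 := hq.prime.associated_of_dvd (linForm_prime (A.coeff_ne_zero i)) hqi
  have h2 := hq.prime.associated_of_dvd (linForm_prime (A.coeff_ne_zero j)) hqj
  obtain ⟨c, hc⟩ := (associated_linForm (A.coeff_ne_zero i) (A.coeff_ne_zero j)).1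
    (h1.symm.trans h2)
  exact A.distinct i j (Finset.ne_of_mem_erase hj).symm c hc

theorem isUnit_C_coeff {i : Fin d} (hi : i ∉ A.pencil) : IsUnit (C (A.coeff i 2) : PolyS) :=
  (IsUnit.mk0 _ fun h => hi (A.mem_pencil.2 h)).map C

theorem isUnit_of_dvd_fst {v : PolyS} (hv : ∀ x ∈ A.pairs, v ∣ x.1) : IsUnit v := by
  classical
  refine A.isUnit_of_dvd_restPoly (hv _ A.restPoly_zero_mem_pairs) fun i hi => ?_
  have := hv _ (A.erase_mem_pairs hi)
  rwa [(A.isUnit_C_coeff hi).dvd_mul_left] at this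

theorem exists_eq_C_of_isUnit {v : PolyS} (hv : IsUnit v) : ∃ κ : ℂ, κ ≠ 0 ∧ v = C κ := by
  obtain ⟨κ, hκ, rfl⟩ := MvPolynomial.isUnit_iff_eq_C_of_isReduced.1 hv
  exact ⟨κ, hκ.ne_zero, rfl⟩

/-- Expand a pair and `(0, restPoly)` in the basis: by Cramer's rule the cofactor `v` of `restPoly`
in the determinant divides every first component, so it is a constant. -/
theorem cross_eq_of_basis (b : Module.Basis (Fin 2) PolyS A.pairs) :
    ∃ κ : ℂ, κ ≠ 0 ∧
      (b 0).1.1 * (b 1).1.2 - (b 1).1.1 * (b 0).1.2 = C κ * A.restPoly := by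
  classical
  obtain ⟨v, hv⟩ := A.restPoly_dvd_cross (b 0).2 (b 1).2
  have hrep : ∀ x ∈ A.pairs, ∃ s t : PolyS, x.1 = s * (b 0).1.1 + t * (b 1).1.1 ∧
      x.2 = s * (b 0).1.2 + t * (b 1).1.2 := by
    intro x hx
    have := b.sum_repr ⟨x, hx⟩
    rw [Fin.sum_univ_two] at this
    exact ⟨_, _, (congrArg (fun z : A.pairs => z.1.1) this).symm,
      (congrArg (fun z : A.pairs => z.1.2) this).symm⟩
  have hdvd : ∀ x ∈ A.pairs, v ∣ x.1 := by
    intro x hx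
    obtain ⟨s, t, h1, h2⟩ := hrep x hx
    obtain ⟨s', t', h1', h2'⟩ := hrep _ A.zero_restPoly_mem_pairs
    simp only at h1' h2'
    refine ⟨s * t' - s' * t, mul_left_cancel₀ A.restPoly_ne_zero ?_⟩
    rw [← mul_assoc, ← hv]
    linear_combination x.1 * h2' - x.2 * h1' + (s' * (b 0).1.2 + t' * (b 1).1.2) * h1 -
      (s' * (b 0).1.1 + t' * (b 1).1.1) * h2
  obtain ⟨κ, hκ, rfl⟩ := exists_eq_C_of_isUnit (A.isUnit_of_dvd_fst hdvd)
  exact ⟨κ, hκ, by rw [hv, mul_comm]⟩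

theorem fst_of_syzygyFun_isHomogeneous (hd : d ≠ 0) (hm : A.pencil.card ≠ 0) {x : A.pairs} {D : ℕ}
    (h : ∀ i, (A.syzygyFun hd x i).IsHomogeneous D) :
    x.1.1 = 0 ∨ ∃ k, x.1.1.IsHomogeneous k ∧ k + A.pencil.card = D + 1 := by
  by_cases h0 : x.1.1 = 0
  · exact Or.inl h0
  right
  have h1 : (C (A.pencil.card : ℂ) * A.pencilPoly * x.1.1).IsHomogeneous (1 + D) := by
    rw [← A.X_mul_syzygyFun_sub hd]
    exact ((isHomogeneous_X _ _).mul (h 1)).sub ((isHomogeneous_X _ _).mul (h 0))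
  have hg : (C (A.pencil.card : ℂ) * A.pencilPoly).IsHomogeneous A.pencil.card :=
    A.pencilPoly_isHomogeneous.C_mul _
  have hle := le_of_isHomogeneous_mul hg h1 (mul_ne_zero (A.C_mul_pencilPoly_ne_zero hm) h0)
  refine ⟨D + 1 - A.pencil.card,
    isHomogeneous_of_mul_left hg (A.C_mul_pencilPoly_ne_zero hm) ?_, by omega⟩
  convert h1 using 1
  omega

/-- The determinant with the Euler field as first row does not see the Euler corrections. Comparing
degrees then gives `d = D + E + 1`. -/
theorem syzygy_det (hd : d ≠ 0) (x y : A.pairs) :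
    X 0 * (A.syzygyFun hd x 1 * A.syzygyFun hd y 2 - A.syzygyFun hd x 2 * A.syzygyFun hd y 1) -
    X 1 * (A.syzygyFun hd x 0 * A.syzygyFun hd y 2 - A.syzygyFun hd x 2 * A.syzygyFun hd y 0) +
    X 2 * (A.syzygyFun hd x 0 * A.syzygyFun hd y 1 - A.syzygyFun hd x 1 * A.syzygyFun hd y 0) =
    C (A.pencil.card : ℂ) * A.pencilPoly * (x.1.1 * y.1.2 - y.1.1 * x.1.2) := by
  simp only [syzygyFun_zero, syzygyFun_one, syzygyFun_two]
  linear_combination (x.1.1 * y.1.2 - y.1.1 * x.1.2) * A.euler_pencilPoly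

theorem card_eq_of_syzygies (hd : d ≠ 0) (hm : A.pencil.card ≠ 0) {x y : A.pairs} {D E : ℕ}
    (hx : ∀ i, (A.syzygyFun hd x i).IsHomogeneous D)
    (hy : ∀ i, (A.syzygyFun hd y i).IsHomogeneous E) {κ : ℂ} (hκ : κ ≠ 0)
    (h : x.1.1 * y.1.2 - y.1.1 * x.1.2 = C κ * A.restPoly) : d = D + E + 1 := by
  have hdet := A.syzygy_det hd x y
  have h1 := ((((isHomogeneous_X ℂ (0 : Fin 3)).mul (((hx 1).mul (hy 2)).sub
    ((hx 2).mul (hy 1)))).sub ((isHomogeneous_X ℂ (1 : Fin 3)).mul (((hx 0).mul (hy 2)).sub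
    ((hx 2).mul (hy 0))))).add ((isHomogeneous_X ℂ (2 : Fin 3)).mul (((hx 0).mul (hy 1)).sub
    ((hx 1).mul (hy 0)))))
  rw [hdet, h] at h1
  have h2 : (C (A.pencil.card : ℂ) * A.pencilPoly * (C κ * A.restPoly)).IsHomogeneous
      (A.pencil.card + A.pencilᶜ.card) :=
    (A.pencilPoly_isHomogeneous.C_mul _).mul (A.restPoly_isHomogeneous.C_mul _)
  have := h1.inj_right h2 (mul_ne_zero (A.C_mul_pencilPoly_ne_zero hm)
    (mul_ne_zero (by simpa using hκ) A.restPoly_ne_zero))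
  rw [A.card_pencil_add] at this
  omega

/-! ### Local conditions at the intersection points -/

open Classical in
/-- The indices of the lines through the intersection point of two lines. -/
noncomputable def linesThrough (i j : Fin d) : Finset (Fin d) :=
  Finset.univ.filter fun k => A.coeff k ∈ Submodule.span ℂ {A.coeff i, A.coeff j}

theorem mem_linesThrough {i j k : Fin d} :
    k ∈ A.linesThrough i j ↔ A.coeff k ∈ Submodule.span ℂ {A.coeff i, A.coeff j} := by
  simp [linesThrough]

open Classical in
/-- The intersection points of multiplicity at least two not lying on a line through `(0 : 0 : 1)`,
each represented by the set of lines through it. -/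
noncomputable def points : Finset (Finset (Fin d)) :=
  (Finset.univ.filter fun q : Fin d × Fin d =>
    q.1 ≠ q.2 ∧ Disjoint (A.linesThrough q.1 q.2) A.pencil).image fun q => A.linesThrough q.1 q.2

theorem mem_points {s : Finset (Fin d)} : s ∈ A.points ↔
    ∃ i j, i ≠ j ∧ Disjoint (A.linesThrough i j) A.pencil ∧ A.linesThrough i j = s := by
  simp only [points, Finset.mem_image, Finset.mem_filter, Finset.mem_univ, true_and, Prod.exists,
    and_assoc]

/-- The number of conditions imposed by the intersection points not on a line through
`(0 : 0 : 1)`. -/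
noncomputable def defect : ℕ := ∑ s ∈ A.points, (s.card - 1)

/-- The coefficients of the line joining the intersection point of two lines to `(0 : 0 : 1)`. -/
noncomputable def joinCoeff (i j : Fin d) : Fin 3 → ℂ :=
  A.coeff i 2 • A.coeff j - A.coeff j 2 • A.coeff i

theorem joinCoeff_two (i j : Fin d) : A.joinCoeff i j 2 = 0 := by
  simp only [joinCoeff, Pi.sub_apply, Pi.smul_apply, smul_eq_mul]; ring

theorem left_mem_linesThrough (i j : Fin d) : i ∈ A.linesThrough i j :=
  A.mem_linesThrough.2 (Submodule.subset_span (by simp))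

theorem right_mem_linesThrough (i j : Fin d) : j ∈ A.linesThrough i j :=
  A.mem_linesThrough.2 (Submodule.subset_span (by simp))

theorem joinCoeff_ne_zero {i j : Fin d} (hi : i ∉ A.pencil) (hij : i ≠ j) :
    A.joinCoeff i j ≠ 0 := by
  intro h
  rw [mem_pencil] at hi
  refine A.distinct i j hij ((A.coeff i 2)⁻¹ * A.coeff j 2) ?_
  rw [joinCoeff, sub_eq_zero] at h
  rw [mul_smul, ← h, inv_smul_smul₀ hi]

theorem joinCoeff_mem_span (i j : Fin d) :
    A.joinCoeff i j ∈ Submodule.span ℂ {A.coeff i, A.coeff j} :=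
  sub_mem (Submodule.smul_mem _ _ (Submodule.subset_span (by simp)))
    (Submodule.smul_mem _ _ (Submodule.subset_span (by simp)))

theorem span_joinCoeff {i : Fin d} (hi : i ∉ A.pencil) (j : Fin d) :
    Submodule.span ℂ {A.joinCoeff i j, A.coeff i} =
      Submodule.span ℂ {A.coeff i, A.coeff j} := by
  rw [mem_pencil] at hi
  apply le_antisymm
  · rw [Submodule.span_le, Set.insert_subset_iff, Set.singleton_subset_iff]
    exact ⟨A.joinCoeff_mem_span i j, Submodule.subset_span (by simp)⟩
  · rw [Submodule.span_le, Set.insert_subset_iff, Set.singleton_subset_iff]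
    refine ⟨Submodule.subset_span (by simp), Submodule.mem_span_pair.2
      ⟨(A.coeff i 2)⁻¹, (A.coeff i 2)⁻¹ * A.coeff j 2, ?_⟩⟩
    rw [joinCoeff, smul_sub, inv_smul_smul₀ hi, mul_smul, sub_add_cancel]

/-- The join has zero third coefficient, which fixes the coefficient of line `i`. For `i` outside
the pencil this reduces the condition on each concurrent line to those of line `i` and the join. -/
theorem exists_slope {i j k : Fin d} (hk : k ∈ A.linesThrough i j) :
    ∃ μ : ℂ, A.coeff i 2 • A.coeff k = A.coeff k 2 • A.coeff i + μ • A.joinCoeff i j := by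
  obtain ⟨α, β, h⟩ := Submodule.mem_span_pair.1 (A.mem_linesThrough.1 hk)
  refine ⟨β, ?_⟩
  rw [← h, joinCoeff]
  ext l
  simp only [Pi.add_apply, Pi.smul_apply, smul_eq_mul, Pi.sub_apply]
  ring

theorem slope_linForm {i j k : Fin d} {μ : ℂ}
    (h : A.coeff i 2 • A.coeff k = A.coeff k 2 • A.coeff i + μ • A.joinCoeff i j) :
    C (A.coeff i 2) * linForm (A.coeff k) =
      C (A.coeff k 2) * linForm (A.coeff i) + C μ * linForm (A.joinCoeff i j) := by
  simp only [← linForm_smul, ← linForm_add, h]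

theorem chi_add (a b : Fin 3 → ℂ) : A.chi (a + b) = A.chi a + A.chi b := by
  simp only [chi, Pi.add_apply, C_add]; ring

theorem chi_smul (c : ℂ) (a : Fin 3 → ℂ) : A.chi (c • a) = C c * A.chi a := by
  simp only [chi, Pi.smul_apply, smul_eq_mul, C_mul]; ring

theorem slope_chi {i j k : Fin d} {μ : ℂ}
    (h : A.coeff i 2 • A.coeff k = A.coeff k 2 • A.coeff i + μ • A.joinCoeff i j) :
    C (A.coeff i 2) * A.chi (A.coeff k) =
      C (A.coeff k 2) * A.chi (A.coeff i) + C μ * A.chi (A.joinCoeff i j) := by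
  simp only [← chi_smul, ← chi_add, h]

theorem slope_self {i j : Fin d} (hi : i ∉ A.pencil) (hij : i ≠ j) {μ : ℂ}
    (h : A.coeff i 2 • A.coeff i = A.coeff i 2 • A.coeff i + μ • A.joinCoeff i j) : μ = 0 := by
  have : μ • A.joinCoeff i j = 0 := by simpa using h
  exact (smul_eq_zero.1 this).resolve_right (A.joinCoeff_ne_zero hi hij)

theorem slope_ne_zero {i j k : Fin d} (hi : i ∉ A.pencil) (hik : i ≠ k) {μ : ℂ}
    (h : A.coeff i 2 • A.coeff k = A.coeff k 2 • A.coeff i + μ • A.joinCoeff i j) : μ ≠ 0 := by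
  rintro rfl
  rw [mem_pencil] at hi
  refine A.distinct i k hik ((A.coeff i 2)⁻¹ * A.coeff k 2) ?_
  rw [zero_smul, add_zero] at h
  rw [mul_smul, ← h, inv_smul_smul₀ hi]

/-- Here `c` is chosen so that the expression for line `i` is the line times `a`. The slope relation
turns the expression for line `k`, up to a unit, into a multiple of that line plus `C μ * p * b`,
and `μ = 0` when `k = i`. -/
theorem exists_local_solution {i j : Fin d} (hi : i ∉ A.pencil) (hij : i ≠ j) {w a p b : PolyS}
    (hp : ∀ k ∈ A.linesThrough i j, k ∉ A.pencil → k ≠ i → linForm (A.coeff k) ∣ p)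
    (h : w * A.chi (A.joinCoeff i j) = linForm (A.joinCoeff i j) * a + p * b) :
    ∃ c, ∀ k ∈ A.linesThrough i j, k ∉ A.pencil →
      linForm (A.coeff k) ∣ w * A.chi (A.coeff k) + C (A.coeff k 2) * c := by
  have hi' : A.coeff i 2 ≠ 0 := fun h => hi (A.mem_pencil.2 h)
  have hC : (C (A.coeff i 2) * C (A.coeff i 2)⁻¹ : PolyS) = 1 := by
    rw [← C_mul, mul_inv_cancel₀ hi', C_1]
  refine ⟨C (A.coeff i 2)⁻¹ * (linForm (A.coeff i) * a - w * A.chi (A.coeff i)), ?_⟩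
  intro k hk hkp
  obtain ⟨μ, hμ⟩ := A.exists_slope hk
  rw [← (A.isUnit_C_coeff hi).dvd_mul_left]
  have e : C (A.coeff i 2) * (w * A.chi (A.coeff k) + C (A.coeff k 2) *
      (C (A.coeff i 2)⁻¹ * (linForm (A.coeff i) * a - w * A.chi (A.coeff i)))) =
      linForm (A.coeff k) * (C (A.coeff i 2) * a) + C μ * p * b := by
    linear_combination w * A.slope_chi hμ + C μ * h - a * A.slope_linForm hμ +
      C (A.coeff k 2) * (linForm (A.coeff i) * a - w * A.chi (A.coeff i)) * hC
  rw [e]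
  refine dvd_add (Dvd.intro _ rfl) (Dvd.dvd.mul_right ?_ _)
  by_cases hki : k = i
  · subst hki
    rw [A.slope_self hi hij hμ, C_0, zero_mul]
    exact dvd_zero _
  · exact (hp k hk hkp hki).mul_left _

theorem linForm_dvd_chi {a : Fin 3 → ℂ} (h : linForm a ∣ A.pencilPoly) : linForm a ∣ A.chi a := by
  obtain ⟨q, hq⟩ := h
  rw [chi, hq]
  simp only [pderiv_mul, pderiv_linForm]
  exact ⟨C (a 1) * pderiv 0 q - C (a 0) * pderiv 1 q, by ring⟩

/-- A line of the pencil through the point is the join, and then it divides its own `chi`. Every `w`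
is allowed, which is why `points` omits such points. -/
theorem exists_local_solution_of_not_disjoint {i j : Fin d} (hi : i ∉ A.pencil) (hij : i ≠ j)
    (h : ¬ Disjoint (A.linesThrough i j) A.pencil) (w : PolyS) :
    ∃ c, ∀ k ∈ A.linesThrough i j, k ∉ A.pencil →
      linForm (A.coeff k) ∣ w * A.chi (A.coeff k) + C (A.coeff k 2) * c := by
  obtain ⟨k, hk, hkp⟩ := Finset.not_disjoint_iff.1 h
  obtain ⟨μ, hμ⟩ := A.exists_slope hk
  have hμ0 := A.slope_ne_zero hi (fun h => hi (h ▸ hkp)) hμ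
  have hi' : A.coeff i 2 ≠ 0 := fun h => hi (A.mem_pencil.2 h)
  rw [A.mem_pencil.1 hkp, zero_smul, zero_add] at hμ
  have ht : linForm (A.joinCoeff i j) ∣ A.pencilPoly := by
    refine dvd_trans ?_ (Finset.dvd_prod_of_mem (fun i => linForm (A.coeff i)) hkp)
    rw [linForm_dvd_linForm (A.joinCoeff_ne_zero hi hij)]
    exact ⟨(A.coeff i 2)⁻¹ * μ, by rw [mul_smul, ← hμ, inv_smul_smul₀ hi']⟩
  obtain ⟨q, hq⟩ := A.linForm_dvd_chi ht
  exact A.exists_local_solution hi hij (w := w) (a := w * q) (p := 0) (b := 0) (by simp)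
    (by rw [hq]; ring)

/-- The conditions on the first component of a pair are local. -/
theorem exists_mem_pairs_of_local (w : PolyS) (h : ∀ s ∈ A.points, ∃ c, ∀ k ∈ s,
    linForm (A.coeff k) ∣ w * A.chi (A.coeff k) + C (A.coeff k 2) * c) :
    ∃ c, (w, c) ∈ A.pairs := by
  have key : ∀ k ∉ A.pencil, ∀ c, linForm (A.coeff k) ∣ c - -(C (A.coeff k 2)⁻¹ *
      (w * A.chi (A.coeff k))) ↔
      linForm (A.coeff k) ∣ w * A.chi (A.coeff k) + C (A.coeff k 2) * c := by
    intro k hk c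
    have hk' : A.coeff k 2 ≠ 0 := fun h => hk (A.mem_pencil.2 h)
    have hC : (C (A.coeff k 2) * C (A.coeff k 2)⁻¹ : PolyS) = 1 := by
      rw [← C_mul, mul_inv_cancel₀ hk', C_1]
    rw [← (A.isUnit_C_coeff hk).dvd_mul_left]
    have : C (A.coeff k 2) * (c - -(C (A.coeff k 2)⁻¹ * (w * A.chi (A.coeff k)))) =
        w * A.chi (A.coeff k) + C (A.coeff k 2) * c := by
      linear_combination w * A.chi (A.coeff k) * hC
    rw [this]
  have H := exists_interpolation A.pencilᶜ A.coeff (fun i _ => A.coeff_ne_zero i)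
    (fun i _ j _ hij => A.distinct i j hij)
    (fun k => -(C (A.coeff k 2)⁻¹ * (w * A.chi (A.coeff k))))
  obtain ⟨c, hc⟩ := H (by
    intro i hi j hj hij
    rw [Finset.mem_compl] at hi hj
    by_cases hdisj : Disjoint (A.linesThrough i j) A.pencil
    · obtain ⟨c, hc⟩ := h _ (A.mem_points.2 ⟨i, j, hij, hdisj, rfl⟩)
      refine ⟨c, fun k hk hk' => (key k (Finset.mem_compl.1 hk) c).2 (hc k ?_)⟩
      exact A.mem_linesThrough.2 hk'
    · obtain ⟨c, hc⟩ := A.exists_local_solution_of_not_disjoint hi hij hdisj w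
      refine ⟨c, fun k hk hk' => (key k (Finset.mem_compl.1 hk) c).2 (hc k ?_
        (Finset.mem_compl.1 hk))⟩
      exact A.mem_linesThrough.2 hk')
  exact ⟨c, fun k hk => (key k hk c).1 (hc k (Finset.mem_compl.2 hk))⟩

open Classical in
-- Modulo the join, each line through the point is a nonzero multiple of line `i`, since none passes
-- through (0:0:1).
theorem exists_prod_erase_sub_pow {i j : Fin d} (hij : i ≠ j)
    (h : Disjoint (A.linesThrough i j) A.pencil) :
    ∃ κ : ℂ, κ ≠ 0 ∧ linForm (A.joinCoeff i j) ∣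
      ∏ k ∈ (A.linesThrough i j).erase i, linForm (A.coeff k) -
        C κ * linForm (A.coeff i) ^ ((A.linesThrough i j).card - 1) := by
  have hp : ∀ k ∈ A.linesThrough i j, A.coeff k 2 ≠ 0 := fun k hk h0 =>
    Finset.disjoint_left.1 h hk (A.mem_pencil.2 h0)
  have hi : i ∉ A.pencil := Finset.disjoint_left.1 h (A.left_mem_linesThrough i j)
  have hi' := hp i (A.left_mem_linesThrough i j)
  obtain ⟨r, -, hra, hrp, -⟩ := exists_restriction (A.joinCoeff_ne_zero hi hij)
  refine ⟨∏ k ∈ (A.linesThrough i j).erase i, ((A.coeff i 2)⁻¹ * A.coeff k 2), ?_, ?_⟩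
  · rw [Finset.prod_ne_zero_iff]
    exact fun k hk => mul_ne_zero (inv_ne_zero hi') (hp k (Finset.mem_of_mem_erase hk))
  · rw [← hrp, map_sub, map_prod, map_mul, linSubst_C, map_pow, sub_eq_zero,
      ← Finset.card_erase_of_mem (A.left_mem_linesThrough i j), ← Finset.prod_const, map_prod,
      ← Finset.prod_mul_distrib]
    refine Finset.prod_congr rfl fun k hk => ?_
    obtain ⟨μ, hμ⟩ := A.exists_slope (Finset.mem_of_mem_erase hk)
    have : A.coeff k = ((A.coeff i 2)⁻¹ * A.coeff k 2) • A.coeff i +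
        ((A.coeff i 2)⁻¹ * μ) • A.joinCoeff i j := by
      rw [mul_smul, mul_smul, ← smul_add, ← hμ, inv_smul_smul₀ hi']
    rw [linSubst_linForm, linSubst_linForm]
    conv_lhs => rw [this]
    rw [map_add, map_smul, map_smul, hra, smul_zero, add_zero, linForm_smul]

/-- Up to a multiple of the join, the power of line `i` may be replaced by the product of the other
lines, as `exists_local_solution` requires. -/
theorem exists_local_solution_of_mem_ideal {i j : Fin d} (hij : i ≠ j)
    (h : Disjoint (A.linesThrough i j) A.pencil) {w a b : PolyS}
    (hw : w = linForm (A.joinCoeff i j) * a +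
      linForm (A.coeff i) ^ ((A.linesThrough i j).card - 1) * b) :
    ∃ c, ∀ k ∈ A.linesThrough i j,
      linForm (A.coeff k) ∣ w * A.chi (A.coeff k) + C (A.coeff k 2) * c := by
  classical
  have hi : i ∉ A.pencil := Finset.disjoint_left.1 h (A.left_mem_linesThrough i j)
  obtain ⟨κ, hκ, q, hq⟩ := A.exists_prod_erase_sub_pow hij h
  have hC : (C κ * C κ⁻¹ : PolyS) = 1 := by
    rw [← C_mul, mul_inv_cancel₀ hκ, C_1]
  obtain ⟨c, hc⟩ := A.exists_local_solution hi hij (w := w)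
    (a := A.chi (A.joinCoeff i j) * (a - C κ⁻¹ * q * b))
    (p := ∏ k ∈ (A.linesThrough i j).erase i, linForm (A.coeff k))
    (b := A.chi (A.joinCoeff i j) * C κ⁻¹ * b)
    (fun k hk _ hki => Finset.dvd_prod_of_mem (fun k => linForm (A.coeff k))
      (Finset.mem_erase.2 ⟨hki, hk⟩))
    (by
      rw [hw]
      linear_combination (-A.chi (A.joinCoeff i j) * C κ⁻¹ * b) * hq -
        A.chi (A.joinCoeff i j) * b *
          linForm (A.coeff i) ^ ((A.linesThrough i j).card - 1) * hC)
  exact ⟨c, fun k hk => hc k hk (Finset.disjoint_left.1 h hk)⟩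

theorem linearIndependent_joinCoeff {i j : Fin d} (hi : i ∉ A.pencil) (hij : i ≠ j) :
    LinearIndependent ℂ ![A.joinCoeff i j, A.coeff i] := by
  rw [LinearIndependent.pair_iff]
  intro s t hst
  have h2 := congrFun hst 2
  simp only [Pi.add_apply, Pi.smul_apply, joinCoeff_two, smul_eq_mul, mul_zero, zero_add,
    Pi.zero_apply] at h2
  have ht : t = 0 := (mul_eq_zero.1 h2).resolve_right fun h => hi (A.mem_pencil.2 h)
  rw [ht, zero_smul, add_zero] at hst
  exact ⟨(smul_eq_zero.1 hst).resolve_right (A.joinCoeff_ne_zero hi hij), ht⟩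

/-- A homogeneous form lies in the ideal of a point with a fat structure along a line as soon as
finitely many of its coefficients vanish. -/
theorem exists_functionals {a b : Fin 3 → ℂ} (hab : LinearIndependent ℂ ![a, b]) (n D : ℕ) :
    ∃ Λ : PolyS →ₗ[ℂ] (Fin n → ℂ), ∀ w : PolyS, w.IsHomogeneous D → Λ w = 0 →
      ∃ u v, w = linForm a * u + linForm b ^ n * v := by
  obtain ⟨N, hNa, hNb⟩ := exists_linearEquiv_of_linearIndependent_pair hab
  -- Once the forms are `X 0` and `X 1`, the monomials of degree `D` outside `(X 0, X 1 ^ n)` are `X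
  -- 1 ^ l * X 2 ^ (D - l)` with `l < n`. Indices `l > D` only add superfluous functionals.
  refine ⟨LinearMap.pi fun l : Fin n =>
    (MvPolynomial.lcoeff ℂ (Finsupp.single 1 (l : ℕ) + Finsupp.single 2 (D - l))).comp
      (linChange N).toLinearMap, fun w hw h0 => ?_⟩
  have hmem : linChange N w ∈ Ideal.span ((fun s => monomial s (1 : ℂ)) ''
      {Finsupp.single (0 : Fin 3) 1, Finsupp.single 1 n}) := by
    rw [mem_ideal_span_monomial_image]
    intro m hm
    by_cases h00 : m 0 = 0
    · refine ⟨_, Or.inr rfl, ?_⟩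
      rw [Finsupp.single_le_iff]
      by_contra! hlt
      have hdeg := (linSubst_isHomogeneous N.toLinearMap hw).degree_eq_sum_deg_support hm
      have hl := congrFun h0 ⟨m 1, hlt⟩
      rw [mem_support_iff] at hm
      apply hm
      have hms : m = Finsupp.single 1 (m 1) + Finsupp.single 2 (D - m 1) := by
        have : D = m 1 + m 2 := by
          rw [hdeg, ← Finsupp.degree_apply, Finsupp.degree_eq_sum, Fin.sum_univ_three, h00, zero_add]
        ext l
        fin_cases l
        · simpa using h00
        · simp
        · simp; omega
      rw [hms]
      exact hl
    · exact ⟨_, Or.inl rfl, by rw [Finsupp.single_le_iff]; omega⟩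
  rw [Set.image_pair, Ideal.mem_span_pair] at hmem
  obtain ⟨u, v, huv⟩ := hmem
  refine ⟨(linChange N).symm u, (linChange N).symm v, (linChange N).injective ?_⟩
  rw [map_add, map_mul, map_mul, map_pow, linChange_linForm, linChange_linForm, hNa, hNb,
    AlgEquiv.apply_symm_apply, AlgEquiv.apply_symm_apply, linForm_single, linForm_single, ← huv,
    X_pow_eq_monomial, X]
  ring

/-- The first components of pairs have codimension at most the defect. -/
theorem exists_defect_functionals (D : ℕ) :
    ∃ Λ : PolyS →ₗ[ℂ] ((s : A.points) → Fin (s.1.card - 1) → ℂ), ∀ w : PolyS,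
      w.IsHomogeneous D → Λ w = 0 → ∃ c, (w, c) ∈ A.pairs := by
  have h : ∀ s : A.points, ∃ Λ : PolyS →ₗ[ℂ] (Fin (s.1.card - 1) → ℂ), ∀ w : PolyS,
      w.IsHomogeneous D → Λ w = 0 → ∃ c, ∀ k ∈ s.1,
        linForm (A.coeff k) ∣ w * A.chi (A.coeff k) + C (A.coeff k 2) * c := by
    rintro ⟨s, hs⟩
    obtain ⟨i, j, hij, hdisj, rfl⟩ := A.mem_points.1 hs
    have hi : i ∉ A.pencil := Finset.disjoint_left.1 hdisj (A.left_mem_linesThrough i j)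
    obtain ⟨Λ, hΛ⟩ := exists_functionals (A.linearIndependent_joinCoeff hi hij)
      ((A.linesThrough i j).card - 1) D
    refine ⟨Λ, fun w hw h0 => ?_⟩
    obtain ⟨u, v, huv⟩ := hΛ w hw h0
    exact A.exists_local_solution_of_mem_ideal hij hdisj huv
  choose Λ hΛ using h
  refine ⟨LinearMap.pi Λ, fun w hw h0 => A.exists_mem_pairs_of_local w fun s hs => ?_⟩
  exact hΛ ⟨s, hs⟩ w hw (congrFun h0 ⟨s, hs⟩)

theorem finrank_defect :
    Module.finrank ℂ ((s : A.points) → Fin (s.1.card - 1) → ℂ) = A.defect := by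
  rw [Module.finrank_pi_fintype, defect]
  simp only [Module.finrank_fin_fun]
  exact Finset.sum_coe_sort A.points fun s => s.card - 1

theorem one_le_card_linesThrough_sub_one {i j : Fin d} (hij : i ≠ j) :
    1 ≤ (A.linesThrough i j).card - 1 := by
  have : 1 < (A.linesThrough i j).card := Finset.one_lt_card.2
    ⟨i, A.left_mem_linesThrough i j, j, A.right_mem_linesThrough i j, hij⟩
  omega

/-- The field `(-g_y, g_x, 0)` is transversal to a line through `(0 : 0 : 1)` at a point outside
the lines of the arrangement through `(0 : 0 : 1)`. -/
theorem not_dvd_linSubst_chi {i j : Fin d} (hij : i ≠ j) (hm : A.pencil.card ≠ 0)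
    (h : Disjoint (A.linesThrough i j) A.pencil) {r : (Fin 3 → ℂ) →ₗ[ℂ] (Fin 3 → ℂ)}
    (hr : ∀ p, linSubst r p = 0 ↔ linForm (A.joinCoeff i j) ∣ p)
    (hr' : ∀ p, linSubst r (linSubst r p) = linSubst r p) :
    ¬ linForm (r (A.coeff i)) ∣ linSubst r (A.chi (A.joinCoeff i j)) := by
  have hi : i ∉ A.pencil := Finset.disjoint_left.1 h (A.left_mem_linesThrough i j)
  set t := A.joinCoeff i j with ht
  have ht2 : t 2 = 0 := A.joinCoeff_two i j
  have ht0 : t ≠ 0 := A.joinCoeff_ne_zero hi hij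
  set a := A.coeff i with ha
  have ha2 : a 2 ≠ 0 := fun h => hi (A.mem_pencil.2 h)
  -- The cross product of `t` and `a`, that is, the intersection point.
  let q : Fin 3 → ℂ := ![t 1 * a 2, -(t 0 * a 2), t 0 * a 1 - t 1 * a 0]
  have hqt : eval q (linForm t) = 0 := by
    rw [eval_linForm, Fin.sum_univ_three, ht2]
    simp [q]; ring
  have hqa : eval q (linForm a) = 0 := by
    rw [eval_linForm, Fin.sum_univ_three]
    simp [q]; ring
  have hev : ∀ p, eval q (linSubst r p) = eval q p := by
    intro p
    obtain ⟨u, hu⟩ := (hr (linSubst r p - p)).1 (by rw [map_sub, hr', sub_self])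
    rw [← sub_eq_zero, ← map_sub, hu, map_mul, hqt, zero_mul]
  rintro ⟨u, hu⟩
  have h1 : eval q (A.chi t) = 0 := by
    rw [← hev, hu, map_mul, ← linSubst_linForm, hev, hqa, zero_mul]
  have h2 := congrArg (eval q) A.euler_pencilPoly
  simp only [chi, map_sub, map_mul, eval_C, map_add, eval_X] at h1 h2
  have hq0 : q 0 = t 1 * a 2 := rfl
  have hq1 : q 1 = -(t 0 * a 2) := rfl
  -- As `(q 0, q 1)` is `a 2` times `(t 1, -t 0)`, Euler's relation turns a zero of `chi t` at `q`
  -- into a zero of `pencilPoly`, so some pencil line would pass through the point.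
  have h3 : eval q A.pencilPoly = 0 := by
    have hm' : (A.pencil.card : ℂ) ≠ 0 := Nat.cast_ne_zero.2 hm
    apply (mul_eq_zero.1 _).resolve_left hm'
    rw [← h2, hq0, hq1]
    linear_combination a 2 * h1
  rw [pencilPoly, map_prod, Finset.prod_eq_zero_iff] at h3
  obtain ⟨k, hk, hk0⟩ := h3
  refine Finset.disjoint_left.1 h (?_ : k ∈ _) hk
  rw [mem_linesThrough]
  have hk2 := A.mem_pencil.1 hk
  rw [eval_linForm, Fin.sum_univ_three, hk2, hq0, hq1] at hk0
  have hk1 : A.coeff k 0 * t 1 - A.coeff k 1 * t 0 = 0 := by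
    apply mul_left_cancel₀ ha2
    linear_combination hk0
  have hc : ∃ c : ℂ, A.coeff k = c • t := by
    by_cases h0 : t 0 = 0
    · have h1 : t 1 ≠ 0 := by
        intro h1
        refine ht0 (funext fun l => ?_)
        fin_cases l <;> assumption
      refine ⟨A.coeff k 1 / t 1, funext fun l => ?_⟩
      have hk3 : A.coeff k 0 = 0 := by
        rw [h0, mul_zero, sub_zero] at hk1
        exact (mul_eq_zero.1 hk1).resolve_right h1
      fin_cases l
      · simp [h0, hk3]
      · simp [h1]
      · simp [ht2, hk2]
    · refine ⟨A.coeff k 0 / t 0, funext fun l => ?_⟩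
      fin_cases l
      · simp [h0]
      · simp only [Fin.mk_one, Pi.smul_apply, smul_eq_mul]
        rw [div_mul_eq_mul_div, eq_div_iff h0]
        linear_combination -hk1
      · simp [ht2, hk2]
  obtain ⟨c, hc⟩ := hc
  rw [hc]
  exact Submodule.smul_mem _ _ (A.joinCoeff_mem_span i j)

/-- Comparing the conditions on line `i` and the other lines eliminates the second component: modulo
the join `t`, the product of the other lines, hence a power of line `i`, divides `x.1 * chi t`.
Since `chi t` does not vanish at the point, the power divides `x.1`. -/
theorem mem_ideal_of_mem_pairs {i j : Fin d} (hij : i ≠ j) (hm : A.pencil.card ≠ 0)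
    (h : Disjoint (A.linesThrough i j) A.pencil) {x : PolyS × PolyS} (hx : x ∈ A.pairs) :
    ∃ u v, x.1 = linForm (A.joinCoeff i j) * u +
      linForm (A.coeff i) ^ ((A.linesThrough i j).card - 1) * v := by
  classical
  have hi : i ∉ A.pencil := Finset.disjoint_left.1 h (A.left_mem_linesThrough i j)
  obtain ⟨r, hr, hra, hrp, hidem, hidem'⟩ := exists_restriction (A.joinCoeff_ne_zero hi hij)
  have hr0 : r (A.coeff i) ≠ 0 := by
    intro h0
    obtain ⟨c, hc⟩ := hr (A.coeff i)
    rw [h0, eq_comm, sub_eq_zero] at hc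
    have := congrFun hc 2
    rw [Pi.smul_apply, joinCoeff_two, smul_zero] at this
    exact hi (A.mem_pencil.2 this)
  obtain ⟨a, ha⟩ := hx i hi
  have hprod : ∏ k ∈ (A.linesThrough i j).erase i, linForm (A.coeff k) ∣
      x.1 * A.chi (A.joinCoeff i j) - linForm (A.joinCoeff i j) * a := by
    apply prod_linForm_dvd'
    intro k hk
    rw [Finset.mem_erase] at hk
    obtain ⟨μ, hμ⟩ := A.exists_slope hk.2
    have hμ0 := A.slope_ne_zero hi hk.1.symm hμ
    have hu : IsUnit (C μ : PolyS) := (IsUnit.mk0 _ hμ0).map C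
    obtain ⟨e, he⟩ := hx k (Finset.disjoint_left.1 h hk.2)
    rw [← hu.dvd_mul_left]
    refine ⟨C (A.coeff i 2) * e - C (A.coeff i 2) * a, ?_⟩
    linear_combination C (A.coeff i 2) * he - x.1 * A.slope_chi hμ + a * A.slope_linForm hμ -
      C (A.coeff k 2) * ha
  obtain ⟨κ, hκ, q, hq⟩ := A.exists_prod_erase_sub_pow hij h
  have hq' := congrArg (linSubst r) hq
  rw [map_sub, map_mul, linSubst_C, map_pow, map_mul, (hrp _).2 dvd_rfl, zero_mul,
    sub_eq_zero] at hq'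
  have h1 := map_dvd (linSubst r) hprod
  rw [hq', map_sub, map_mul, map_mul, (hrp _).2 dvd_rfl, zero_mul, sub_zero,
    linSubst_linForm] at h1
  have h2 := (linForm_prime hr0).pow_dvd_of_dvd_mul_right _
    (A.not_dvd_linSubst_chi hij hm h hrp hidem') ((Dvd.intro_left _ rfl).trans h1)
  obtain ⟨v, hv⟩ := h2
  obtain ⟨u, hu⟩ := (hrp (x.1 - linForm (A.coeff i) ^ ((A.linesThrough i j).card - 1) *
      linSubst r v)).1 (by
    rw [map_sub, map_mul, map_pow, hidem', linSubst_linForm, ← hidem', hv, map_mul, map_pow,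
      linSubst_linForm, hidem, sub_self])
  exact ⟨u, linSubst r v, by linear_combination hu⟩

/-! ### Freeness bounds the defect -/

/-- A point would put `1` in an ideal `(t, ℓ ^ (n - 1))` with `n ≥ 2`, whose elements vanish at the
origin. -/
theorem defect_eq_zero_of_one_mem (hm : A.pencil.card ≠ 0) {c : PolyS} (h : (1, c) ∈ A.pairs) :
    A.defect = 0 := by
  rw [defect]
  refine Finset.sum_eq_zero fun s hs => ?_
  obtain ⟨i, j, hij, hdisj, rfl⟩ := A.mem_points.1 hs
  obtain ⟨u, v, huv⟩ := A.mem_ideal_of_mem_pairs hij hm hdisj h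
  have h1 := A.one_le_card_linesThrough_sub_one hij
  have := congrArg (eval (0 : Fin 3 → ℂ)) huv
  simp only [map_one, map_add, map_mul, map_pow, eval_linForm, Pi.zero_apply, mul_zero,
    Finset.sum_const_zero, zero_mul, zero_add] at this
  rw [zero_pow (by omega), zero_mul] at this
  exact absurd this one_ne_zero

theorem exists_one_mem_of_isUnit {x : PolyS × PolyS} (hx : x ∈ A.pairs) (hu : IsUnit x.1) :
    ∃ c, (1, c) ∈ A.pairs := by
  obtain ⟨v, hv⟩ := hu.exists_left_inv
  have := A.pairs.smul_mem v hx
  refine ⟨v * x.2, ?_⟩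
  rw [← hv]
  exact this

/-- If a linear form `ω` belongs to the first components of pairs, then all points counted by the
defect lie on the line `ω = 0`. -/
theorem exists_span_of_linForm_mem (hm : A.pencil.card ≠ 0) {ω : Fin 3 → ℂ} (hω : ω ≠ 0)
    {c : PolyS} (hc : (linForm ω, c) ∈ A.pairs) {y : PolyS × PolyS} (hy : y ∈ A.pairs)
    {i j : Fin d} (hij : i ≠ j) (h : Disjoint (A.linesThrough i j) A.pencil) :
    ∃ b, Submodule.span ℂ {A.coeff i, A.coeff j} = Submodule.span ℂ {ω, b} ∧
      ∃ u v, y.1 = linForm ω * u + linForm b ^ ((A.linesThrough i j).card - 1) * v := by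
  have hi : i ∉ A.pencil := Finset.disjoint_left.1 h (A.left_mem_linesThrough i j)
  obtain ⟨r, hr, hra, hrp, hidem, hidem'⟩ := exists_restriction (A.joinCoeff_ne_zero hi hij)
  obtain ⟨u, v, huv⟩ := A.mem_ideal_of_mem_pairs hij hm h hc
  obtain ⟨u', v', huv'⟩ := A.mem_ideal_of_mem_pairs hij hm h hy
  have h1 := A.one_le_card_linesThrough_sub_one hij
  rw [← A.span_joinCoeff hi]
  simp only at huv
  have huvr := congrArg (linSubst r) huv
  rw [map_add, map_mul, map_mul, map_pow, linSubst_linForm, linSubst_linForm, linSubst_linForm,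
    hra, linForm_eq_zero.2 rfl, zero_mul, zero_add] at huvr
  -- Either `ω` is a multiple of the join, and `b` is line `i`; or the exponent must be 1, and `b`
  -- can be the join, as `ω` and the join then span the same plane of forms.
  by_cases h0 : r ω = 0
  · obtain ⟨e, he⟩ := hr ω
    rw [h0, eq_comm, sub_eq_zero] at he
    have he0 : e ≠ 0 := by
      rintro rfl
      rw [zero_smul] at he
      exact hω he
    have ht : A.joinCoeff i j = e⁻¹ • ω := by rw [he, inv_smul_smul₀ he0]
    refine ⟨A.coeff i, ?_, C e⁻¹ * u', v', ?_⟩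
    · apply le_antisymm
      · rw [Submodule.span_le, Set.insert_subset_iff, Set.singleton_subset_iff, ht]
        exact ⟨Submodule.smul_mem _ _ (Submodule.subset_span (by simp)),
          Submodule.subset_span (by simp)⟩
      · rw [Submodule.span_le, Set.insert_subset_iff, Set.singleton_subset_iff, he]
        exact ⟨Submodule.smul_mem _ _ (Submodule.subset_span (by simp)),
          Submodule.subset_span (by simp)⟩
    · rw [huv', ht, linForm_smul]; ring
  · have hk : (A.linesThrough i j).card - 1 = 1 := by
      have h2 := le_of_isHomogeneous_mul ((linForm_isHomogeneous (r (A.coeff i))).pow _)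
        (huvr ▸ linForm_isHomogeneous (r ω)) (huvr ▸ linForm_eq_zero.not.2 h0)
      omega
    rw [hk, pow_one] at huvr huv'
    have hi0 : r (A.coeff i) ≠ 0 := by
      intro hi0
      rw [hi0, linForm_eq_zero.2 rfl, zero_mul, linForm_eq_zero] at huvr
      exact h0 huvr
    obtain ⟨e, he⟩ := (linForm_dvd_linForm hi0).1 (Dvd.intro _ huvr.symm)
    have he0 : e ≠ 0 := by
      rintro rfl
      rw [zero_smul] at he
      exact h0 he
    obtain ⟨e₁, h₁⟩ := hr ω
    obtain ⟨e₂, h₂⟩ := hr (A.coeff i)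
    have hω' : ω = e • A.coeff i + (e₁ - e * e₂) • A.joinCoeff i j := by
      rw [h₁, h₂, smul_sub, smul_smul, sub_eq_iff_eq_add] at he
      rw [he, sub_smul]; abel
    have hai : A.coeff i = e⁻¹ • ω + (-(e⁻¹ * (e₁ - e * e₂))) • A.joinCoeff i j := by
      conv_rhs => rw [hω']
      rw [smul_add, inv_smul_smul₀ he0, smul_smul, neg_smul, add_neg_cancel_right]
    refine ⟨A.joinCoeff i j, ?_, C e⁻¹ * v', u' - C (e⁻¹ * (e₁ - e * e₂)) * v', ?_⟩
    · apply le_antisymm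
      · rw [Submodule.span_le, Set.insert_subset_iff, Set.singleton_subset_iff]
        refine ⟨Submodule.subset_span (by simp), Submodule.mem_span_pair.2 ⟨_, _, hai.symm⟩⟩
      · rw [Submodule.span_le, Set.insert_subset_iff, Set.singleton_subset_iff]
        refine ⟨Submodule.mem_span_pair.2 ⟨_, _, (add_comm _ _).trans hω'.symm⟩,
          Submodule.subset_span (by simp)⟩
    · rw [hk, pow_one, huv']
      have := congrArg linForm hai
      rw [linForm_add, linForm_smul, linForm_smul, C_neg] at this
      linear_combination v' * this

/-- Restricted to `ω = 0`, the form `y.1` is nonzero and vanishes to order `n - 1` at each point.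
Distinct points give coprime forms on the line, so the orders add up to at most the degree. -/
theorem defect_le_of_linForm_mem (hm : A.pencil.card ≠ 0) {ω : Fin 3 → ℂ} (hω : ω ≠ 0)
    {c : PolyS} (hc : (linForm ω, c) ∈ A.pairs) {y : PolyS × PolyS} (hy : y ∈ A.pairs)
    {e : ℕ} (hye : y.1.IsHomogeneous e) (hndvd : ¬ linForm ω ∣ y.1) : A.defect ≤ e := by
  classical
  have H : ∀ s : A.points, ∃ b, ∃ i j, i ≠ j ∧ A.linesThrough i j = s.1 ∧
      Submodule.span ℂ {A.coeff i, A.coeff j} = Submodule.span ℂ {ω, b} ∧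
      ∃ u v, y.1 = linForm ω * u + linForm b ^ (s.1.card - 1) * v := by
    rintro ⟨s, hs⟩
    obtain ⟨i, j, hij, hdisj, rfl⟩ := A.mem_points.1 hs
    obtain ⟨b, hb⟩ := A.exists_span_of_linForm_mem hm hω hc hy hij hdisj
    exact ⟨b, i, j, hij, rfl, hb⟩
  choose b hb using H
  have hpt : ∀ s : A.points, ∀ k, k ∈ s.1 ↔ A.coeff k ∈ Submodule.span ℂ {ω, b s} := by
    intro s k
    obtain ⟨i, j, hij, hs, hsp, -⟩ := hb s
    rw [← hs, mem_linesThrough, hsp]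
  obtain ⟨r, hr, hra, hrp, hidem, hidem'⟩ := exists_restriction hω
  have hb0 : ∀ s, r (b s) ≠ 0 := by
    intro s h0
    obtain ⟨i, j, hij, hs, hsp, -⟩ := hb s
    obtain ⟨e, he⟩ := hr (b s)
    rw [h0, eq_comm, sub_eq_zero] at he
    have hline : ∀ k, A.coeff k ∈ Submodule.span ℂ {ω, b s} → ∃ f : ℂ, A.coeff k = f • ω := by
      intro k hk
      obtain ⟨f, g, hfg⟩ := Submodule.mem_span_pair.1 hk
      exact ⟨f + g * e, by rw [← hfg, he, smul_smul, add_smul]⟩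
    obtain ⟨f, hf⟩ := hline i (hsp ▸ Submodule.subset_span (by simp))
    obtain ⟨g, hg⟩ := hline j (hsp ▸ Submodule.subset_span (by simp))
    have hf0 : f ≠ 0 := by
      rintro rfl
      rw [zero_smul] at hf
      exact A.coeff_ne_zero i hf
    refine A.distinct i j hij (g * f⁻¹) ?_
    rw [hf, hg, smul_smul, mul_assoc, inv_mul_cancel₀ hf0, mul_one]
  have hsub : ∀ s s', (∃ e : ℂ, r (b s') = e • r (b s)) → b s' ∈ Submodule.span ℂ {ω, b s} := by
    rintro s s' ⟨e, he⟩
    obtain ⟨c₁, h₁⟩ := hr (b s)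
    obtain ⟨c₂, h₂⟩ := hr (b s')
    rw [h₁, h₂, smul_sub, smul_smul, sub_eq_iff_eq_add] at he
    rw [he]
    exact Submodule.mem_span_pair.2 ⟨c₂ - e * c₁, e, by rw [sub_smul]; abel⟩
  have hle : ∀ s s', (∃ e : ℂ, r (b s') = e • r (b s)) → s'.1 ⊆ s.1 := by
    intro s s' h k hk
    rw [hpt] at hk ⊢
    refine Submodule.span_le.2 ?_ hk
    rw [Set.insert_subset_iff, Set.singleton_subset_iff]
    exact ⟨Submodule.subset_span (by simp), hsub s s' h⟩
  have hdvd : ∏ s : A.points, linForm (r (b s)) ^ (s.1.card - 1) ∣ linSubst r y.1 := by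
    apply Finset.prod_dvd_of_isRelPrime
    · intro s _ s' _ hss
      apply IsRelPrime.pow
      refine ((linForm_prime (hb0 s)).irreducible.isRelPrime_iff_not_dvd).2 fun h => hss ?_
      have h' := (linForm_prime (hb0 s)).associated_of_dvd (linForm_prime (hb0 s')) h
      apply Subtype.ext
      exact Finset.Subset.antisymm
        (hle s' s ((associated_linForm (hb0 s') (hb0 s)).1 h'.symm))
        (hle s s' ((associated_linForm (hb0 s) (hb0 s')).1 h'))
    · intro s _
      obtain ⟨i, j, hij, hs, hsp, u, v, huv⟩ := hb s
      refine ⟨linSubst r v, ?_⟩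
      rw [huv, map_add, map_mul, (hrp _).2 dvd_rfl, zero_mul, zero_add, map_mul, map_pow,
        linSubst_linForm]
  obtain ⟨q, hq⟩ := hdvd
  have hhom : (∏ s : A.points, linForm (r (b s)) ^ (s.1.card - 1)).IsHomogeneous A.defect := by
    have := IsHomogeneous.prod Finset.univ (fun s : A.points => linForm (r (b s)) ^ (s.1.card - 1))
      (fun s => s.1.card - 1) (fun s _ => by
        simpa using (linForm_isHomogeneous (r (b s))).pow (s.1.card - 1))
    rwa [Finset.sum_coe_sort A.points fun s => s.card - 1] at this
  exact le_of_isHomogeneous_mul hhom (hq ▸ linSubst_isHomogeneous r hye)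
    (hq ▸ fun h => hndvd ((hrp _).1 h))

/-- The numerical consequences of freeness. -/
theorem defect_of_isFreeWithExponents {d₁ d₂ : ℕ} (h : IsFreeWithExponents A.poly d₁ d₂)
    (hm : A.pencil.card ≠ 0) (hd₁ : d₁ ≤ A.pencil.card) :
    A.defect = 0 ∨ (A.pencil.card = d₁ ∧ d = d₁ + d₂ + 1 ∧ d₁ ≤ d₂ ∧
      A.defect + d₁ ≤ d₂ + 1) := by
  have hd : d ≠ 0 := by
    have := A.card_pencil_add
    omega
  obtain ⟨hle, b, hb⟩ := h
  let b' := b.map (A.syzygyEquiv hd hm).symm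
  have hb' : ∀ j i, (A.syzygyFun hd (b' j) i).IsHomogeneous (![d₁, d₂] j) := by
    intro j i
    rw [← A.syzygyEquiv_apply hd hm]
    simp only [b', Module.Basis.map_apply, LinearEquiv.apply_symm_apply]
    exact hb j i
  obtain ⟨κ, hκ, hcross⟩ := A.cross_eq_of_basis b'
  have hcard := A.card_eq_of_syzygies hd hm (hb' 0) (hb' 1) hκ hcross
  have hrep : ∀ x ∈ A.pairs, ∃ s t : PolyS, x.1 = s * (b' 0).1.1 + t * (b' 1).1.1 := by
    intro x hx
    have := b'.sum_repr ⟨x, hx⟩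
    rw [Fin.sum_univ_two] at this
    exact ⟨_, _, (congrArg (fun z : A.pairs => z.1.1) this).symm⟩
  -- First components have no common factor, so one dividing all of them is a unit.
  have hunit : ∀ j, (∀ x ∈ A.pairs, (b' j).1.1 ∣ x.1) → A.defect = 0 := by
    intro j hj
    obtain ⟨c, hc⟩ := A.exists_one_mem_of_isUnit (b' j).2 (A.isUnit_of_dvd_fst hj)
    exact A.defect_eq_zero_of_one_mem hm hc
  by_cases hne : (b' 0).1.1 = 0
  · left
    apply hunit 1
    intro x hx
    obtain ⟨s, t, hst⟩ := hrep x hx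
    rw [hst, hne, mul_zero, zero_add]
    exact Dvd.intro_left _ rfl
  by_cases h00 : (b' 0).1.1 ∣ (b' 1).1.1
  · left
    apply hunit 0
    intro x hx
    obtain ⟨s, t, hst⟩ := hrep x hx
    rw [hst]
    exact dvd_add (Dvd.intro_left _ rfl) (h00.mul_left _)
  obtain ⟨k, hk, hkm⟩ := (A.fst_of_syzygyFun_isHomogeneous hd hm (hb' 0)).resolve_left hne
  change k + A.pencil.card = d₁ + 1 at hkm
  -- This is where the multiplicity bound `d₁ ≤ m` enters.
  have hk1 : k = 0 ∨ k = 1 := by omega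
  rcases hk1 with rfl | rfl
  · obtain ⟨c, hc⟩ := exists_eq_C_of_isHomogeneous_zero hk
    have hc0 : c ≠ 0 := by
      rintro rfl
      rw [C_0] at hc
      exact hne hc
    refine absurd ?_ h00
    rw [hc]
    exact ((IsUnit.mk0 _ hc0).map C).dvd
  · right
    refine ⟨by omega, hcard, hle, ?_⟩
    obtain ⟨ω, hω⟩ := exists_linForm_of_isHomogeneous_one hk
    have hω0 : ω ≠ 0 := by
      rintro rfl
      rw [linForm_eq_zero.2 rfl] at hω
      exact hne hω
    rcases A.fst_of_syzygyFun_isHomogeneous hd hm (hb' 1) with h1 | ⟨l, hl, hlm⟩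
    · exact absurd (h1 ▸ dvd_zero _) h00
    · change l + A.pencil.card = d₂ + 1 at hlm
      have := A.defect_le_of_linForm_mem hm hω0 (c := (b' 0).1.2) (hω ▸ (b' 0).2) (b' 1).2 hl
        (hω ▸ h00)
      omega

/-! ### A small defect forces freeness -/

theorem linForm_dvd_homogeneousComponent {a : Fin 3 → ℂ} {p : PolyS} (h : linForm a ∣ p) (k : ℕ) :
    linForm a ∣ homogeneousComponent k p := by
  obtain ⟨q, rfl⟩ := h
  rcases k with _ | k
  · have : MvPolynomial.coeff 0 (linForm a * q) = 0 := by
      rw [← constantCoeff_eq, map_mul]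
      simp [linForm]
    rw [homogeneousComponent_zero, this, C_0]
    exact dvd_zero _
  · rw [add_comm, homogeneousComponent_mul_of_isHomogeneous (linForm_isHomogeneous a)]
    exact Dvd.intro _ rfl

theorem chi_isHomogeneous (a : Fin 3 → ℂ) : (A.chi a).IsHomogeneous (A.pencil.card - 1) :=
  (A.pencilPoly_isHomogeneous.pderiv.C_mul _).sub (A.pencilPoly_isHomogeneous.pderiv.C_mul _)

/-- The tangency condition splits by degree, with the second component shifted by the degree `m - 1`
of `chi`. -/
theorem homogeneousComponent_mem_pairs {x : PolyS × PolyS} (hx : x ∈ A.pairs) (k : ℕ) :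
    (homogeneousComponent k x.1, homogeneousComponent (k + (A.pencil.card - 1)) x.2) ∈
      A.pairs := by
  intro i hi
  have := linForm_dvd_homogeneousComponent (hx i hi) (k + (A.pencil.card - 1))
  rw [map_add, homogeneousComponent_C_mul, mul_comm x.1, add_comm k,
    homogeneousComponent_mul_of_isHomogeneous (A.chi_isHomogeneous _), mul_comm (A.chi _)] at this
  rwa [add_comm k]

/-- The homogeneous pairs with first component of degree `k`. -/
noncomputable def homogeneousPairs (k : ℕ) : Submodule ℂ (PolyS × PolyS) :=
  A.pairs.restrictScalars ℂ ⊓ (homogeneousSubmodule (Fin 3) ℂ k).prod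
    (homogeneousSubmodule (Fin 3) ℂ (k + (A.pencil.card - 1)))

theorem mem_homogeneousPairs {k : ℕ} {x : PolyS × PolyS} : x ∈ A.homogeneousPairs k ↔
    x ∈ A.pairs ∧ x.1.IsHomogeneous k ∧ x.2.IsHomogeneous (k + (A.pencil.card - 1)) := by
  simp [homogeneousPairs, Submodule.mem_inf, Submodule.mem_prod]

theorem isHomogeneousPair_of_mem (hm : A.pencil.card ≠ 0) {k : ℕ} {x : PolyS × PolyS}
    (hx : x ∈ A.homogeneousPairs k) : A.IsHomogeneousPair x (k + (A.pencil.card - 1)) := by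
  rw [mem_homogeneousPairs] at hx
  exact ⟨Or.inr ⟨k, hx.2.1, by omega⟩, hx.2.2⟩

theorem exists_mem_homogeneousPairs {k : ℕ} {w c : PolyS} (hw : w.IsHomogeneous k)
    (hc : (w, c) ∈ A.pairs) : ∃ c', (w, c') ∈ A.homogeneousPairs k := by
  refine ⟨homogeneousComponent (k + (A.pencil.card - 1)) c, A.mem_homogeneousPairs.2
    ⟨?_, hw, homogeneousComponent_isHomogeneous _ _⟩⟩
  have := A.homogeneousComponent_mem_pairs hc k
  rwa [homogeneousComponent_eq_self hw] at this

theorem isFreeCurve_of_one_mem (hm : A.pencil.card ≠ 0) {c : PolyS} (hc : (1, c) ∈ A.pairs) :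
    IsFreeCurve A.poly := by
  obtain ⟨c', hc'⟩ := A.exists_mem_homogeneousPairs (isHomogeneous_one _ _) hc
  exact A.isFreeCurve_of_pairs hm (A.mem_homogeneousPairs.1 hc').1 A.zero_restPoly_mem_pairs
    (A.isHomogeneousPair_of_mem hm hc') ⟨Or.inl rfl, A.restPoly_isHomogeneous⟩ one_ne_zero
    (by simp)

theorem exists_mem_pairs_of_defect_lt {k : ℕ}
    (h : A.defect < Module.finrank ℂ (homogeneousSubmodule (Fin 3) ℂ k)) :
    ∃ w c, w ≠ 0 ∧ (w, c) ∈ A.homogeneousPairs k := by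
  obtain ⟨Λ, hΛ⟩ := A.exists_defect_functionals k
  have hker := LinearMap.ker_ne_bot_of_finrank_lt
    (f := Λ.domRestrict (homogeneousSubmodule (Fin 3) ℂ k)) (by rwa [finrank_defect])
  obtain ⟨⟨w, hw⟩, hw0, hne⟩ := Submodule.exists_mem_ne_zero_of_ne_bot hker
  obtain ⟨c, hc⟩ := hΛ w hw hw0
  obtain ⟨c', hc'⟩ := A.exists_mem_homogeneousPairs hw hc
  exact ⟨w, c', fun h => hne (Subtype.ext h), hc'⟩

theorem isFreeCurve_of_defect_eq_zero (hm : A.pencil.card ≠ 0) (h : A.defect = 0) :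
    IsFreeCurve A.poly := by
  obtain ⟨w, c, hw, hc⟩ := A.exists_mem_pairs_of_defect_lt (k := 0) (by
    have := finrank_homogeneousSubmodule 0
    omega)
  rw [mem_homogeneousPairs] at hc
  obtain ⟨e, rfl⟩ := exists_eq_C_of_isHomogeneous_zero hc.2.1
  obtain ⟨c', hc'⟩ := A.exists_one_mem_of_isUnit hc.1
    ((IsUnit.mk0 e fun h => hw (by rw [h, C_0])).map C)
  exact A.isFreeCurve_of_one_mem hm hc'

instance finite_homogeneousPairs (k : ℕ) : Module.Finite ℂ (A.homogeneousPairs k) := by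
  have : Module.Finite ℂ ((homogeneousSubmodule (Fin 3) ℂ k).prod
      (homogeneousSubmodule (Fin 3) ℂ (k + (A.pencil.card - 1)))) :=
    Module.Finite.iff_fg.2 ((homogeneousSubmodule_fg _ _ _).prod (homogeneousSubmodule_fg _ _ _))
  exact Submodule.finiteDimensional_of_le (inf_le_right : A.homogeneousPairs k ≤ _)

theorem finrank_le_finrank_homogeneousPairs_add (k : ℕ) :
    Module.finrank ℂ (homogeneousSubmodule (Fin 3) ℂ k) ≤
      Module.finrank ℂ (A.homogeneousPairs k) + A.defect := by
  obtain ⟨Λ, hΛ⟩ := A.exists_defect_functionals k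
  set f := Λ.domRestrict (homogeneousSubmodule (Fin 3) ℂ k) with hf
  have h1 := f.finrank_range_add_finrank_ker
  have h2 : Module.finrank ℂ f.range ≤ A.defect :=
    (Submodule.finrank_le _).trans_eq A.finrank_defect
  have h3 : f.ker.map (homogeneousSubmodule (Fin 3) ℂ k).subtype ≤
      (A.homogeneousPairs k).map (LinearMap.fst ℂ PolyS PolyS) := by
    rintro _ ⟨⟨w, hw⟩, hw0, rfl⟩
    obtain ⟨c, hc⟩ := hΛ w hw hw0
    obtain ⟨c', hc'⟩ := A.exists_mem_homogeneousPairs hw hc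
    exact ⟨_, hc', rfl⟩
  have h4 : Module.finrank ℂ f.ker ≤ _ :=
    (Submodule.finrank_map_subtype_eq _ _).symm.trans_le (Submodule.finrank_mono h3)
  have h5 := Submodule.finrank_map_le (LinearMap.fst ℂ PolyS PolyS) (A.homogeneousPairs k)
  calc _ = _ := h1.symm
    _ ≤ A.defect + Module.finrank ℂ (A.homogeneousPairs k) := add_le_add h2 (h4.trans h5)
    _ = _ := add_comm _ _

/-- A pair proportional to a pair of minimal degree is a multiple of it. -/
theorem fst_dvd_of_proportional {x y : PolyS × PolyS} (hx : x ∈ A.pairs) (hy : y ∈ A.pairs)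
    (hx0 : x.1 ≠ 0) (hmin : ∀ z ∈ A.pairs, z.1 ≠ 0 → x.1.totalDegree ≤ z.1.totalDegree)
    (h : x.1 * y.2 = y.1 * x.2) : x.1 ∣ y.1 := by
  obtain ⟨b, a, g, hab, hb, ha⟩ := UniqueFactorizationMonoid.exists_reduced_factors x.1 hx0 y.1
  have hg0 : g ≠ 0 := by
    rintro rfl
    exact hx0 (by rw [← hb, zero_mul])
  have hb0 : b ≠ 0 := by
    rintro rfl
    exact hx0 (by rw [← hb, mul_zero])
  have h1 : b * y.2 = a * x.2 := by
    apply mul_left_cancel₀ hg0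
    rw [← mul_assoc, ← mul_assoc, hb, ha, h]
  obtain ⟨t, ht⟩ := hab.dvd_of_dvd_mul_left (Dvd.intro _ h1)
  have ht' : y.2 = a * t := by
    apply mul_left_cancel₀ hb0
    rw [h1, ht]; ring
  -- Both pairs are multiples of `(g, t)`, by the coprime factors `b` and `a`. A line cannot divide
  -- both factors, so the common pair satisfies each condition; minimality then makes `b` constant.
  have hgt : (g, t) ∈ A.pairs := by
    intro i hi
    have hp := linForm_prime (A.coeff_ne_zero i)
    have h2 := hx i hi
    have h3 := hy i hi
    rw [← hb, ht, show g * b * A.chi (A.coeff i) + C (A.coeff i 2) * (b * t) =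
      b * (g * A.chi (A.coeff i) + C (A.coeff i 2) * t) by ring] at h2
    rw [← ha, ht', show g * a * A.chi (A.coeff i) + C (A.coeff i 2) * (a * t) =
      a * (g * A.chi (A.coeff i) + C (A.coeff i 2) * t) by ring] at h3
    rcases hp.dvd_or_dvd h2 with h2 | h2
    · exact (hp.dvd_or_dvd h3).resolve_left fun h3 => hp.not_isUnit (hab h2 h3)
    · exact h2
  have hdeg := hmin _ hgt hg0
  rw [← hb, totalDegree_mul_of_isDomain hg0 hb0] at hdeg
  have hb1 : b.totalDegree = 0 := by
    simp only at hdeg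
    omega
  rw [totalDegree_eq_zero_iff_eq_C] at hb1
  have hbu : IsUnit b := by
    rw [hb1]
    refine (IsUnit.mk0 _ fun h => hb0 ?_).map C
    rw [hb1, h, C_0]
  rw [← hb, ← ha]
  exact mul_dvd_mul_left g hbu.dvd

theorem exists_minimal_pair : ∃ k, ∃ x ∈ A.homogeneousPairs k, x.1 ≠ 0 ∧
    ∀ z ∈ A.pairs, z.1 ≠ 0 → k ≤ z.1.totalDegree := by
  classical
  have key : ∀ z ∈ A.pairs, z.1 ≠ 0 → ∃ k ≤ z.1.totalDegree, ∃ x ∈ A.homogeneousPairs k,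
      x.1 ≠ 0 := by
    intro z hz hz0
    obtain ⟨k, hk⟩ : ∃ k, homogeneousComponent k z.1 ≠ 0 := by
      by_contra! h
      apply hz0
      rw [← sum_homogeneousComponent z.1]
      exact Finset.sum_eq_zero fun k _ => h k
    refine ⟨k, ?_, _, A.mem_homogeneousPairs.2 ⟨A.homogeneousComponent_mem_pairs hz k,
      homogeneousComponent_isHomogeneous _ _, homogeneousComponent_isHomogeneous _ _⟩, hk⟩
    by_contra! hlt
    exact hk (homogeneousComponent_eq_zero _ _ hlt)
  have hex : ∃ k, ∃ x ∈ A.homogeneousPairs k, x.1 ≠ 0 := by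
    obtain ⟨k, -, hk⟩ := key _ A.restPoly_zero_mem_pairs A.restPoly_ne_zero
    exact ⟨k, hk⟩
  obtain ⟨x, hx, hx0⟩ := Nat.find_spec hex
  refine ⟨Nat.find hex, x, hx, hx0, fun z hz hz0 => ?_⟩
  obtain ⟨k, hk, hk'⟩ := key z hz hz0
  exact (Nat.find_min' hex hk').trans hk

/-- The determinant with a fixed pair. -/
noncomputable def crossMap (x : PolyS × PolyS) : PolyS × PolyS →ₗ[ℂ] PolyS :=
  (LinearMap.mulLeft ℂ x.1).comp (LinearMap.snd ℂ PolyS PolyS) -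
    (LinearMap.mulRight ℂ x.2).comp (LinearMap.fst ℂ PolyS PolyS)

theorem crossMap_apply (x y : PolyS × PolyS) : crossMap x y = x.1 * y.2 - y.1 * x.2 := by
  simp [crossMap]

theorem exists_crossMap_eq {k l j : ℕ} {x y : PolyS × PolyS} (hx : x ∈ A.homogeneousPairs k)
    (hy : y ∈ A.homogeneousPairs l) (hj : k + l + (A.pencil.card - 1) = A.pencilᶜ.card + j) :
    ∃ v : PolyS, v.IsHomogeneous j ∧ crossMap x y = A.restPoly * v := by
  rw [mem_homogeneousPairs] at hx hy
  obtain ⟨v, hv⟩ := A.restPoly_dvd_cross hx.1 hy.1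
  refine ⟨v, isHomogeneous_of_mul_left A.restPoly_isHomogeneous A.restPoly_ne_zero ?_,
    by rw [crossMap_apply, hv]⟩
  rw [← hv, ← hj]
  refine IsHomogeneous.sub ?_ ?_
  · rw [add_assoc]; exact hx.2.1.mul hy.2.2
  · have := hy.2.1.mul hx.2.2
    rwa [← add_assoc, add_comm l k] at this

theorem finrank_range_crossMap_le {k l j : ℕ} {x : PolyS × PolyS} (hx : x ∈ A.homogeneousPairs k)
    (hj : k + l + (A.pencil.card - 1) = A.pencilᶜ.card + j) :
    Module.finrank ℂ ((crossMap x).domRestrict (A.homogeneousPairs l)).range ≤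
      Module.finrank ℂ (homogeneousSubmodule (Fin 3) ℂ j) := by
  refine le_trans (Submodule.finrank_mono ?_)
    (Submodule.finrank_map_le (LinearMap.mulLeft ℂ A.restPoly) _)
  rintro _ ⟨⟨y, hy⟩, rfl⟩
  obtain ⟨v, hv, h⟩ := A.exists_crossMap_eq hx hy hj
  exact ⟨v, hv, h.symm⟩

/-- A pair with zero determinant against the minimal pair is a multiple of it, by a form of degree
`j`. -/
theorem finrank_ker_crossMap_le {k j : ℕ} {x : PolyS × PolyS} (hx : x ∈ A.homogeneousPairs k)
    (hx0 : x.1 ≠ 0) (hmin : ∀ z ∈ A.pairs, z.1 ≠ 0 → k ≤ z.1.totalDegree) :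
    Module.finrank ℂ ((crossMap x).domRestrict (A.homogeneousPairs (k + j))).ker ≤
      Module.finrank ℂ (homogeneousSubmodule (Fin 3) ℂ j) := by
  let m : PolyS →ₗ[ℂ] PolyS × PolyS := (LinearMap.mulLeft ℂ x.1).prod (LinearMap.mulLeft ℂ x.2)
  rw [← Submodule.finrank_map_subtype_eq]
  refine le_trans (Submodule.finrank_mono ?_) (Submodule.finrank_map_le m _)
  rintro _ ⟨⟨y, hy⟩, hy0, rfl⟩
  have h : x.1 * y.2 - y.1 * x.2 = 0 := by
    rw [← crossMap_apply]; exact hy0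
  rw [mem_homogeneousPairs] at hx hy
  obtain ⟨v, hv⟩ := A.fst_dvd_of_proportional hx.1 hy.1 hx0
    (by rwa [hx.2.1.totalDegree hx0]) (sub_eq_zero.1 h)
  refine ⟨v, isHomogeneous_of_mul_left hx.2.1 hx0 (hv ▸ hy.2.1), Prod.ext hv.symm ?_⟩
  apply mul_left_cancel₀ hx0
  change x.1 * (x.2 * v) = x.1 * y.2
  linear_combination -h - x.2 * hv

/-- For a pair of minimal degree `k`, the determinants with pairs of degree `e` lie in `restPoly *
S_{k-1}`, with kernel of dimension at most `dim S_{e-k}`. Since `dim S_e - dim S_{e-k} - dim S_{k-1}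
= e + (k-1)(e-k)`, a defect at most `e` excludes `2 ≤ k < e`. For `k = 1` some determinant is a
nonzero constant times `restPoly`; for `k = 0` a pair `(1, c)` exists. -/
theorem isFreeCurve_of_defect_le (hm : A.pencil.card ≠ 0) {e : ℕ} (he : 1 ≤ e)
    (hn : A.pencilᶜ.card = e + A.pencil.card) (hdef : A.defect ≤ e) : IsFreeCurve A.poly := by
  obtain ⟨k, x, hx, hx0, hmin⟩ := A.exists_minimal_pair
  have hS := finrank_homogeneousSubmodule
  have hsmall : ∀ l, A.defect < Module.finrank ℂ (homogeneousSubmodule (Fin 3) ℂ l) → k ≤ l := by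
    intro l hl
    obtain ⟨w, c, hw, hc⟩ := A.exists_mem_pairs_of_defect_lt hl
    rw [mem_homogeneousPairs] at hc
    exact (hmin _ hc.1 hw).trans hc.2.1.totalDegree_le
  obtain ⟨f, rfl⟩ : ∃ f, e = f + 1 := ⟨e - 1, by omega⟩
  -- `dim S_f > f + 1` once `f ≥ 1`, while `dim S_1 = 3` covers `f = 0`. Thus `k ≥ 2` implies `k <
  -- e`.
  have hk1 : k ≤ max f 1 := by
    apply hsmall
    rcases Nat.eq_zero_or_pos f with rfl | hf
    · have := hS 1
      rw [max_eq_right zero_le_one]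
      omega
    · rw [max_eq_left hf]
      have := hS f
      nlinarith
  rcases Nat.eq_zero_or_pos k with rfl | hk
  · rw [mem_homogeneousPairs] at hx
    obtain ⟨c, hc⟩ := exists_eq_C_of_isHomogeneous_zero hx.2.1
    have hu : IsUnit x.1 := by
      rw [hc]
      exact (IsUnit.mk0 c fun h => hx0 (by rw [hc, h, C_0])).map C
    obtain ⟨c', hc'⟩ := A.exists_one_mem_of_isUnit hx.1 hu
    exact A.isFreeCurve_of_one_mem hm hc'
  obtain ⟨l, rfl⟩ : ∃ l, k = l + 1 := ⟨k - 1, by omega⟩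
  obtain ⟨j, hj⟩ : ∃ j, f + 1 = l + 1 + j := ⟨f - l, by omega⟩
  have hdeg : l + 1 + (f + 1) + (A.pencil.card - 1) = A.pencilᶜ.card + l := by omega
  have h1 := A.finrank_range_crossMap_le hx hdeg
  have h2 := A.finrank_ker_crossMap_le (j := j) hx hx0 hmin
  rw [← hj] at h2
  have h3 := ((crossMap x).domRestrict (A.homogeneousPairs (f + 1))).finrank_range_add_finrank_ker
  have h4 := A.finrank_le_finrank_homogeneousPairs_add (f + 1)
  have hl := hS l
  have hj' := hS j
  have hf' := hS (f + 1)
  obtain rfl : f = l + j := by omega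
  rcases Nat.eq_zero_or_pos l with rfl | hl0
  · have hpos : 0 < Module.finrank ℂ
        ((crossMap x).domRestrict (A.homogeneousPairs (0 + j + 1))).range := by
      nlinarith
    have hne : ((crossMap x).domRestrict (A.homogeneousPairs (0 + j + 1))).range ≠ ⊥ := by
      intro h
      rw [h, finrank_bot] at hpos
      exact lt_irrefl _ hpos
    obtain ⟨_, ⟨⟨y, hy⟩, rfl⟩, hy0⟩ := Submodule.exists_mem_ne_zero_of_ne_bot hne
    obtain ⟨v, hv, hxy⟩ := A.exists_crossMap_eq hx hy hdeg
    obtain ⟨κ, rfl⟩ := exists_eq_C_of_isHomogeneous_zero hv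
    refine A.isFreeCurve_of_pairs hm (A.mem_homogeneousPairs.1 hx).1
      (A.mem_homogeneousPairs.1 hy).1 (A.isHomogeneousPair_of_mem hm hx)
      (A.isHomogeneousPair_of_mem hm hy) (κ := κ) ?_ ?_
    · rintro rfl
      apply hy0
      rw [LinearMap.domRestrict_apply, hxy, C_0, mul_zero]
    · rw [← crossMap_apply, hxy, mul_comm]
  · exfalso
    have hj0 : 1 ≤ j := by
      rcases le_total (l + j) 1 with h | h
      · rw [max_eq_right h] at hk1; omega
      · rw [max_eq_left h] at hk1; omega
    nlinarith [mul_pos hl0 hj0]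

end LineArrangement

/-! ### Invariance under changes of coordinates and transfer along incidences -/

theorem linChange_symm_apply (N : (Fin 3 → ℂ) ≃ₗ[ℂ] (Fin 3 → ℂ)) (p : PolyS) :
    linChange N.symm (linChange N p) = p := (linChange N).symm_apply_apply p

theorem sum_smul_single (b : Fin 3 → ℂ) : ∑ k, b k • (Pi.single k 1 : Fin 3 → ℂ) = b := by
  ext k; fin_cases k <;> simp [Fin.sum_univ_three]

namespace LineArrangement

/-- The transform of a vector field under a linear change of variables. -/
noncomputable def pushField (N : (Fin 3 → ℂ) ≃ₗ[ℂ] (Fin 3 → ℂ)) (a : Fin 3 → PolyS) :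
    Fin 3 → PolyS :=
  fun k => linChange N (vectorField a (linForm (N.symm (Pi.single k 1))))

theorem vectorField_pushField_linForm (N : (Fin 3 → ℂ) ≃ₗ[ℂ] (Fin 3 → ℂ)) (a : Fin 3 → PolyS)
    (b : Fin 3 → ℂ) : vectorField (pushField N a) (linForm b) =
      linChange N (vectorField a (linForm (N.symm b))) := by
  have hC : ∀ c, linChange N (C c) = C c := linSubst_C _
  conv_rhs => rw [← sum_smul_single b]
  simp only [vectorField_linForm, pushField, Fin.sum_univ_three, map_add, map_smul, map_mul, hC,
    Pi.add_apply, Pi.smul_apply, smul_eq_mul]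
  ring

theorem vectorField_pushField (N : (Fin 3 → ℂ) ≃ₗ[ℂ] (Fin 3 → ℂ)) (a : Fin 3 → PolyS)
    (p : PolyS) : vectorField (pushField N a) (linChange N p) =
      linChange N (vectorField a p) := by
  induction p using MvPolynomial.induction_on with
  | C c =>
    rw [show linChange N (C c) = C c from linSubst_C _ c, derivation_C, derivation_C, map_zero]
  | add p q hp hq => rw [map_add, map_add, hp, hq, map_add, map_add]
  | mul_X p i hp =>
    have hX : vectorField (pushField N a) (linChange N (X i)) =
        linChange N (vectorField a (X i)) := by
      rw [← linForm_single, linChange_linForm, vectorField_pushField_linForm,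
        LinearEquiv.symm_apply_apply]
    rw [map_mul, Derivation.leibniz, Derivation.leibniz, hp, hX]
    simp only [smul_eq_mul, map_add, map_mul]

theorem pushField_mem {N : (Fin 3 → ℂ) ≃ₗ[ℂ] (Fin 3 → ℂ)} {f : PolyS} {a : Fin 3 → PolyS}
    (ha : a ∈ jacobianSyzygies f) : pushField N a ∈ jacobianSyzygies (linChange N f) := by
  rw [mem_jacobianSyzygies_iff_vectorField] at ha ⊢
  rw [vectorField_pushField, ha, map_zero]

theorem pushField_symm (N : (Fin 3 → ℂ) ≃ₗ[ℂ] (Fin 3 → ℂ)) (a : Fin 3 → PolyS) :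
    pushField N.symm (pushField N a) = a := by
  funext k
  rw [pushField, vectorField_pushField_linForm, LinearEquiv.symm_symm,
    LinearEquiv.symm_apply_apply, linChange_symm_apply, linForm_single, vectorField_apply]
  fin_cases k <;> simp [pderiv_X]

theorem pushField_combination (N : (Fin 3 → ℂ) ≃ₗ[ℂ] (Fin 3 → ℂ)) (s t : PolyS)
    (a b : Fin 3 → PolyS) : pushField N (s • a + t • b) =
      linChange N s • pushField N a + linChange N t • pushField N b := by
  funext k
  simp only [pushField, vectorField_linForm, Pi.add_apply, Pi.smul_apply, smul_eq_mul, map_add,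
    map_mul]
  ring

theorem pushField_isHomogeneous (N : (Fin 3 → ℂ) ≃ₗ[ℂ] (Fin 3 → ℂ)) {a : Fin 3 → PolyS} {D : ℕ}
    (ha : ∀ i, (a i).IsHomogeneous D) (k : Fin 3) : (pushField N a k).IsHomogeneous D := by
  refine linSubst_isHomogeneous N.toLinearMap ?_
  rw [vectorField_linForm]
  have h : ∀ i c, (a i * C c).IsHomogeneous D := fun i c => by
    rw [mul_comm]; exact (ha i).C_mul c
  exact ((h 0 _).add (h 1 _)).add (h 2 _)

theorem isFreeWithExponents_linChange (N : (Fin 3 → ℂ) ≃ₗ[ℂ] (Fin 3 → ℂ)) {f : PolyS}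
    {d₁ d₂ : ℕ} (h : IsFreeWithExponents f d₁ d₂) :
    IsFreeWithExponents (linChange N f) d₁ d₂ := by
  obtain ⟨hle, b, hb⟩ := h
  have hinj : ∀ x : PolyS, linChange N.symm x = 0 → x = 0 := fun x hx =>
    (linChange N.symm).injective (by rw [hx, map_zero])
  have hbli := b.linearIndependent
  let v : Fin 2 → jacobianSyzygies (linChange N f) :=
    ![⟨pushField N (b 0), pushField_mem (b 0).2⟩, ⟨pushField N (b 1), pushField_mem (b 1).2⟩]
  have hli : LinearIndependent PolyS v := by
    rw [LinearIndependent.pair_iff]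
    intro s t hst
    have h0 : s • pushField N (b 0) + t • pushField N (b 1) = 0 := congrArg Subtype.val hst
    have h1 := congrArg (pushField N.symm) h0
    rw [pushField_combination, pushField_symm, pushField_symm] at h1
    have h2 : ∑ i, (![linChange N.symm s, linChange N.symm t] : Fin 2 → PolyS) i • b i = 0 := by
      apply Subtype.ext
      rw [Fin.sum_univ_two]
      refine Eq.trans h1 ?_
      funext k
      simp [pushField, vectorField_linForm]
    have h3 := Fintype.linearIndependent_iff.1 hbli _ h2
    exact ⟨hinj _ (h3 0), hinj _ (h3 1)⟩
  have hsp : ⊤ ≤ Submodule.span PolyS (Set.range v) := by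
    rintro ⟨z, hz⟩ -
    have hrange : Set.range v = {v 0, v 1} := by simp [v, Set.pair_comm]
    have hz' : pushField N.symm z ∈ jacobianSyzygies f := by
      have := pushField_mem (N := N.symm) hz
      rwa [linChange_symm_apply] at this
    have hrep := b.sum_repr ⟨_, hz'⟩
    rw [Fin.sum_univ_two] at hrep
    have hrep' := congrArg (fun y : jacobianSyzygies f => pushField N y) hrep
    simp only [Submodule.coe_add, Submodule.coe_smul, pushField_combination] at hrep'
    rw [show pushField N (pushField N.symm z) = z from pushField_symm N.symm z] at hrep'
    rw [hrange, Submodule.mem_span_pair]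
    exact ⟨_, _, Subtype.ext hrep'⟩
  refine ⟨hle, Module.Basis.mk hli hsp, fun j i => ?_⟩
  rw [Module.Basis.mk_apply]
  fin_cases j
  · exact pushField_isHomogeneous N (hb 0) i
  · exact pushField_isHomogeneous N (hb 1) i

theorem exists_linearEquiv_apply_two {p : Fin 3 → ℂ} (hp : p ≠ 0) :
    ∃ N : (Fin 3 → ℂ) ≃ₗ[ℂ] (Fin 3 → ℂ), ∀ a, N a 2 = ∑ j, a j * p j := by
  obtain ⟨k, hk⟩ : ∃ k, p k ≠ 0 := by
    by_contra! h
    exact hp (funext h)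
  -- Evaluation at `p` goes last, so lines through `p` get third coefficient zero. The other entries
  -- are the coordinates besides `k`, with indices mod 3; `p k ≠ 0` gives injectivity.
  let f : (Fin 3 → ℂ) →ₗ[ℂ] (Fin 3 → ℂ) := LinearMap.pi ![LinearMap.proj (k + 1),
    LinearMap.proj (k + 2), Fintype.linearCombination ℂ p]
  have hf2 : ∀ a, f a 2 = ∑ j, a j * p j := fun a => by
    simp [f, Fintype.linearCombination_apply]
  have hf : Function.Injective f := by
    rw [injective_iff_map_eq_zero]
    intro a ha
    have h0 : a (k + 1) = 0 := congrFun ha 0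
    have h1 : a (k + 2) = 0 := congrFun ha 1
    have h2 := hf2 a
    have hall : ∀ k l : Fin 3, l = k ∨ l = k + 1 ∨ l = k + 2 := by decide
    rw [ha, Pi.zero_apply, Finset.sum_eq_single k (fun l _ hl => ?_) (by simp)] at h2
    · have hk0 : a k = 0 := (mul_eq_zero.1 h2.symm).resolve_right hk
      ext l
      rcases hall k l with rfl | rfl | rfl <;> assumption
    · rcases (hall k l).resolve_left hl with rfl | rfl
      · rw [h0, zero_mul]
      · rw [h1, zero_mul]
  exact ⟨LinearEquiv.ofInjectiveEndo f hf, hf2⟩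

variable {d d' : ℕ}

/-- The image of an arrangement under a linear change of variables and a renumbering. -/
noncomputable def transform (B : LineArrangement d') (N : (Fin 3 → ℂ) ≃ₗ[ℂ] (Fin 3 → ℂ))
    (σ : Fin d ≃ Fin d') : LineArrangement d where
  coeff i := N (B.coeff (σ i))
  coeff_ne_zero i := by
    rw [ne_eq, LinearEquiv.map_eq_zero_iff]
    exact B.coeff_ne_zero _
  distinct i j hij c h := by
    rw [← map_smul] at h
    exact B.distinct _ _ (σ.injective.ne hij) c (N.injective h)

theorem transform_coeff (B : LineArrangement d') (N : (Fin 3 → ℂ) ≃ₗ[ℂ] (Fin 3 → ℂ))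
    (σ : Fin d ≃ Fin d') (i : Fin d) : (B.transform N σ).coeff i = N (B.coeff (σ i)) := rfl

theorem transform_poly (B : LineArrangement d') (N : (Fin 3 → ℂ) ≃ₗ[ℂ] (Fin 3 → ℂ))
    (σ : Fin d ≃ Fin d') : (B.transform N σ).poly = linChange N B.poly := by
  rw [poly, poly, map_prod, ← Equiv.prod_comp σ]
  exact Finset.prod_congr rfl fun i _ => (linChange_linForm N _).symm

theorem isFreeCurve_of_transform {B : LineArrangement d'} {N : (Fin 3 → ℂ) ≃ₗ[ℂ] (Fin 3 → ℂ)}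
    {σ : Fin d ≃ Fin d'} (h : IsFreeCurve (B.transform N σ).poly) : IsFreeCurve B.poly := by
  obtain ⟨d₁, d₂, h⟩ := h
  rw [transform_poly] at h
  have := isFreeWithExponents_linChange N.symm h
  rw [linChange_symm_apply] at this
  exact ⟨d₁, d₂, this⟩

theorem mem_span_pair_map (N : (Fin 3 → ℂ) ≃ₗ[ℂ] (Fin 3 → ℂ)) (a b c : Fin 3 → ℂ) :
    N a ∈ Submodule.span ℂ {N b, N c} ↔ a ∈ Submodule.span ℂ {b, c} := by
  simp only [Submodule.mem_span_pair, ← map_smul, ← map_add, N.injective.eq_iff]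

/-- Freeness is inherited along a bijection between the lines preserving concurrency, in the
presence of corresponding points of high multiplicity. -/
theorem isFreeCurve_of_incidence {A : LineArrangement d} {B : LineArrangement d'} {d₁ d₂ : ℕ}
    (hA : IsFreeWithExponents A.poly d₁ d₂) (σ : Fin d ≃ Fin d')
    (hσ : ∀ i j k, A.coeff k ∈ Submodule.span ℂ {A.coeff i, A.coeff j} ↔
      B.coeff (σ k) ∈ Submodule.span ℂ {B.coeff (σ i), B.coeff (σ j)})
    {p p' : Fin 3 → ℂ} (hp : p ≠ 0) (hp' : p' ≠ 0)
    (hpp : ∀ i, ∑ j, A.coeff i j * p j = 0 ↔ ∑ j, B.coeff (σ i) j * p' j = 0)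
    {s : Finset (Fin d)} (hs : ∀ i ∈ s, ∑ j, A.coeff i j * p j = 0) (hs0 : s.Nonempty)
    (hsd : d₁ ≤ s.card) : IsFreeCurve B.poly := by
  obtain ⟨N, hN⟩ := exists_linearEquiv_apply_two hp
  obtain ⟨N', hN'⟩ := exists_linearEquiv_apply_two hp'
  set A' := A.transform N (Equiv.refl _) with hA'
  set B' := B.transform N' σ with hB'
  have hpencil : A'.pencil = B'.pencil := by
    ext i
    rw [mem_pencil, mem_pencil, transform_coeff, transform_coeff, hN, hN']
    exact hpp i
  have hlines : A'.linesThrough = B'.linesThrough := by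
    funext i j
    ext k
    simp only [mem_linesThrough, hA', hB', transform_coeff, mem_span_pair_map]
    exact hσ i j k
  -- The defect depends only on the pencil and on the sets of concurrent lines.
  have hdefect : A'.defect = B'.defect := by
    rw [defect, defect, points, points, hpencil, hlines]
  have hsub : s ⊆ A'.pencil := by
    intro i hi
    rw [mem_pencil, transform_coeff, hN]
    exact hs i hi
  have hcard := Finset.card_le_card hsub
  have hm : A'.pencil.card ≠ 0 := by
    have := hs0.card_pos
    omega
  have hm' : B'.pencil.card ≠ 0 := hpencil ▸ hm
  have hfree : IsFreeWithExponents A'.poly d₁ d₂ := by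
    rw [transform_poly]
    exact isFreeWithExponents_linChange N hA
  apply isFreeCurve_of_transform (N := N') (σ := σ)
  rcases A'.defect_of_isFreeWithExponents hfree hm (hsd.trans hcard) with h | ⟨h1, h2, h3, h4⟩
  · exact B'.isFreeCurve_of_defect_eq_zero hm' (hdefect ▸ h)
  · have := B'.card_pencil_add
    rw [hpencil] at h1
    rw [hdefect] at h4
    -- Since `m = d₁`, the number of remaining lines is `d - m = d₂ + 1 = (d₂ - d₁ + 1) + m`.
    exact B'.isFreeCurve_of_defect_le hm' (e := d₂ - d₁ + 1) (by omega) (by omega) (by omega)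

end LineArrangement

/-! ### From the intersection lattice to concurrency of lines -/

namespace LineArrangement
variable {d d' : ℕ} (A : LineArrangement d)

theorem mem_line {i : Fin d} {v : Fin 3 → ℂ} : v ∈ A.line i ↔ ∑ j, A.coeff i j * v j = 0 := Iff.rfl

theorem linearIndependent_coeff {i j : Fin d} (hij : i ≠ j) :
    LinearIndependent ℂ ![A.coeff i, A.coeff j] := by
  rw [LinearIndependent.pair_iff' (A.coeff_ne_zero i)]
  exact fun c h => A.distinct i j hij c h.symm

theorem inf_line_le_line_iff {i j k : Fin d} : A.line i ⊓ A.line j ≤ A.line k ↔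
    A.coeff k ∈ Submodule.span ℂ {A.coeff i, A.coeff j} := by
  have hmem : ∀ i v, v ∈ A.line i ↔ dotProductEquiv ℂ (Fin 3) (A.coeff i) v = 0 := fun i v => Iff.rfl
  constructor
  · intro h
    have := mem_span_of_iInf_ker_le_ker (𝕜 := ℂ)
      (L := fun l : Fin 2 => dotProductEquiv ℂ (Fin 3) (![A.coeff i, A.coeff j] l))
      (K := dotProductEquiv ℂ (Fin 3) (A.coeff k)) (by
        intro v hv
        simp only [Submodule.mem_iInf, LinearMap.mem_ker] at hv
        rw [LinearMap.mem_ker, ← hmem]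
        exact h ⟨(hmem i v).2 (hv 0), (hmem j v).2 (hv 1)⟩)
    have hr : Set.range (fun l : Fin 2 => dotProductEquiv ℂ (Fin 3) (![A.coeff i, A.coeff j] l)) =
        {dotProductEquiv ℂ (Fin 3) (A.coeff i), dotProductEquiv ℂ (Fin 3) (A.coeff j)} := by
      ext x
      simp [Fin.exists_fin_two, eq_comm]
    rw [hr, Submodule.mem_span_pair] at this
    obtain ⟨s, t, hst⟩ := this
    rw [← map_smul, ← map_smul, ← map_add, EmbeddingLike.apply_eq_iff_eq] at hst
    exact Submodule.mem_span_pair.2 ⟨s, t, hst⟩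
  · rintro h v ⟨hi, hj⟩
    obtain ⟨s, t, hst⟩ := Submodule.mem_span_pair.1 h
    have hi' := (hmem i v).1 hi
    have hj' := (hmem j v).1 hj
    rw [hmem, ← hst, map_add, map_smul, map_smul, LinearMap.add_apply, LinearMap.smul_apply,
      LinearMap.smul_apply, hi', hj', smul_zero, smul_zero, add_zero]

theorem eq_of_line_le_line {i j : Fin d} (h : A.line i ≤ A.line j) : i = j := by
  by_contra hij
  have : A.line i ⊓ A.line i ≤ A.line j := by rwa [inf_idem]
  rw [inf_line_le_line_iff, Set.pair_eq_singleton, Submodule.mem_span_singleton] at this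
  obtain ⟨c, hc⟩ := this
  exact A.distinct i j hij c hc.symm

theorem line_ne_top (i : Fin d) : A.line i ≠ ⊤ := by
  intro h
  refine A.coeff_ne_zero i (funext fun k => ?_)
  have : (Pi.single k 1 : Fin 3 → ℂ) ∈ A.line i := h ▸ Submodule.mem_top
  rw [mem_line] at this
  simpa [Pi.single_apply] using this

/-- The flats of an arrangement, ordered by inclusion. -/
abbrev Flats : Type := ↥(Set.range A.flat)

theorem flat_singleton (i : Fin d) : A.flat {i} = A.line i := by simp [flat]

theorem flat_pair (i j : Fin d) : A.flat {i, j} = A.line i ⊓ A.line j := by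
  classical
  rw [flat, Finset.iInf_insert, Finset.iInf_singleton]

/-- A line, as an element of the intersection lattice. -/
def lineFlat (i : Fin d) : A.Flats := ⟨A.line i, {i}, A.flat_singleton i⟩

theorem lineFlat_injective : Function.Injective A.lineFlat := fun _ _ h =>
  A.eq_of_line_le_line (congrArg Subtype.val h).le

theorem flat_le_line {I : Finset (Fin d)} {i : Fin d} (hi : i ∈ I) : A.flat I ≤ A.line i :=
  iInf₂_le i hi

theorem isTop_flat_empty : IsTop (⟨A.flat ∅, ∅, rfl⟩ : A.Flats) := by
  intro X
  change X.1 ≤ A.flat ∅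
  simp [flat]

theorem not_isTop_lineFlat (i : Fin d) : ¬ IsTop (A.lineFlat i) := by
  intro h
  have : A.flat ∅ ≤ A.line i := h ⟨A.flat ∅, ∅, rfl⟩
  apply A.line_ne_top i
  simpa [flat] using this

/-- The lines are the maximal proper flats. -/
theorem exists_eq_lineFlat_iff (X : A.Flats) : (∃ i, X = A.lineFlat i) ↔
    ¬ IsTop X ∧ ∀ Y, X < Y → IsTop Y := by
  constructor
  · rintro ⟨i, rfl⟩
    refine ⟨A.not_isTop_lineFlat i, ?_⟩
    rintro ⟨_, I, rfl⟩ hY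
    rcases I.eq_empty_or_nonempty with rfl | ⟨j, hj⟩
    · exact A.isTop_flat_empty
    · have h1 : A.line i ≤ A.flat I := hY.le
      have hij := A.eq_of_line_le_line (h1.trans (A.flat_le_line hj))
      subst hij
      exact absurd (A.flat_le_line hj : A.flat I ≤ A.line i) hY.not_ge
  · rintro ⟨hX, hmax⟩
    obtain ⟨_, I, rfl⟩ := X
    rcases I.eq_empty_or_nonempty with rfl | ⟨j, hj⟩
    · exact absurd A.isTop_flat_empty hX
    · refine ⟨j, ?_⟩
      by_contra hne
      have hle : (⟨A.flat I, I, rfl⟩ : A.Flats) ≤ A.lineFlat j := A.flat_le_line hj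
      exact A.not_isTop_lineFlat j (hmax _ (lt_of_le_of_ne hle hne))

/-- The intersection of two lines is itself a flat, so the order alone detects concurrency. -/
theorem inf_line_le_line_iff_flats {i j k : Fin d} : A.line i ⊓ A.line j ≤ A.line k ↔
    ∀ X, X ≤ A.lineFlat i → X ≤ A.lineFlat j → X ≤ A.lineFlat k := by
  classical
  constructor
  · intro h X hi hj
    exact (le_inf hi hj : X.1 ≤ _).trans h
  · intro h
    have := h ⟨A.flat {i, j}, _, rfl⟩ (A.flat_le_line (by simp)) (A.flat_le_line (by simp))
    rwa [← flat_pair]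

variable {A} {B : LineArrangement d'}

theorem exists_eq_lineFlat_of_orderIso (e : A.Flats ≃o B.Flats) (i : Fin d) :
    ∃ j, e (A.lineFlat i) = B.lineFlat j := by
  have h := (A.exists_eq_lineFlat_iff _).1 ⟨i, rfl⟩
  rw [exists_eq_lineFlat_iff]
  have hiso : ∀ X, IsTop (e X) ↔ IsTop X := fun X =>
    ⟨fun hX Y => e.le_iff_le.1 (hX (e Y)), fun hX Y => by
      rw [← e.apply_symm_apply Y, e.le_iff_le]; exact hX _⟩
  refine ⟨fun ht => h.1 ((hiso _).1 ht), fun Y hY => ?_⟩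
  rw [← e.apply_symm_apply Y, hiso]
  apply h.2
  rwa [← e.lt_iff_lt, e.apply_symm_apply]

/-- An isomorphism of intersection lattices induces a bijection of the lines preserving
concurrency. -/
theorem exists_equiv_of_orderIso (e : A.Flats ≃o B.Flats) : ∃ σ : Fin d ≃ Fin d', ∀ i j k,
    A.coeff k ∈ Submodule.span ℂ {A.coeff i, A.coeff j} ↔
      B.coeff (σ k) ∈ Submodule.span ℂ {B.coeff (σ i), B.coeff (σ j)} := by
  choose σ hσ using exists_eq_lineFlat_of_orderIso e
  have hinj : Function.Injective σ := fun i j hij =>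
    A.lineFlat_injective (e.injective (by rw [hσ, hσ, hij]))
  have hsurj : Function.Surjective σ := by
    intro j
    obtain ⟨i, hi⟩ := exists_eq_lineFlat_of_orderIso e.symm j
    refine ⟨i, B.lineFlat_injective ?_⟩
    rw [← hσ, ← hi, e.apply_symm_apply]
  have hbij : Function.Bijective σ := ⟨hinj, hsurj⟩
  refine ⟨Equiv.ofBijective σ hbij, fun i j k => ?_⟩
  rw [← inf_line_le_line_iff, ← inf_line_le_line_iff, inf_line_le_line_iff_flats,
    inf_line_le_line_iff_flats]
  simp only [Equiv.ofBijective_apply, ← hσ]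
  constructor
  · intro h X hi hj
    rw [← e.apply_symm_apply X, e.le_iff_le] at hi hj ⊢
    exact h _ hi hj
  · intro h X hi hj
    have := h (e X) (e.le_iff_le.2 hi) (e.le_iff_le.2 hj)
    exact e.le_iff_le.1 this

open Matrix in
/-- The intersection point of two lines. -/
theorem exists_point (A : LineArrangement d) {i j : Fin d} (hij : i ≠ j) :
    ∃ p : Fin 3 → ℂ, p ≠ 0 ∧ ∑ l, A.coeff i l * p l = 0 ∧ ∑ l, A.coeff j l * p l = 0 :=
  ⟨crossProduct (A.coeff i) (A.coeff j),
    crossProduct_ne_zero_iff_linearIndependent.2 (A.linearIndependent_coeff hij),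
    dot_self_cross _ _, dot_cross_self _ _⟩

theorem sum_mul_eq_zero_iff_mem_span (A : LineArrangement d) {i j : Fin d} (hij : i ≠ j)
    {p : Fin 3 → ℂ} (hp : p ≠ 0) (hi : ∑ l, A.coeff i l * p l = 0)
    (hj : ∑ l, A.coeff j l * p l = 0) (c : Fin 3 → ℂ) :
    ∑ l, c l * p l = 0 ↔ c ∈ Submodule.span ℂ {A.coeff i, A.coeff j} := by
  have hφ : ∀ c, Fintype.linearCombination ℂ p c = ∑ l, c l * p l := fun c => by
    simp [Fintype.linearCombination_apply]
  have hne : Fintype.linearCombination ℂ p ≠ 0 := by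
    intro h
    refine hp (funext fun k => ?_)
    have := LinearMap.congr_fun h (Pi.single k 1)
    simpa [Fintype.linearCombination_apply, Pi.single_apply] using this
  have hle : Submodule.span ℂ {A.coeff i, A.coeff j} ≤ (Fintype.linearCombination ℂ p).ker := by
    rw [Submodule.span_le, Set.insert_subset_iff, Set.singleton_subset_iff]
    exact ⟨(hφ _).trans hi, (hφ _).trans hj⟩
  have h1 : Module.finrank ℂ (Submodule.span ℂ {A.coeff i, A.coeff j}) = 2 := by
    have := finrank_span_eq_card (A.linearIndependent_coeff hij)
    rwa [Matrix.range_cons, Matrix.range_cons, Matrix.range_empty, Set.union_empty,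
      Set.singleton_union] at this
  have h2 : Module.finrank ℂ (Fintype.linearCombination ℂ p).ker = 2 := by
    have h3 := (Fintype.linearCombination ℂ p).finrank_range_add_finrank_ker
    rw [LinearMap.range_eq_top.2 (LinearMap.surjective hne), finrank_top] at h3
    simp at h3
    omega
  rw [Submodule.eq_of_le_of_finrank_eq hle (h1.trans h2.symm), LinearMap.mem_ker, hφ]

theorem exists_linesThrough_of_le_maxMultiplicity (A : LineArrangement d) (hd : 2 ≤ d) {m : ℕ}
    (hm : m ≤ A.maxMultiplicity) : ∃ i j, i ≠ j ∧ m ≤ (A.linesThrough i j).card := by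
  classical
  rcases Set.eq_empty_or_nonempty {m : ℕ | 2 ≤ m ∧ ∃ p, A.multiplicity p = m} with h | h
  -- The supremum of the empty set is 0, so any two lines serve.
  · rw [maxMultiplicity, h, csSup_empty] at hm
    exact ⟨⟨0, by omega⟩, ⟨1, by omega⟩, by simp, hm.trans (Nat.zero_le _)⟩
  · have hbdd : BddAbove {m : ℕ | 2 ≤ m ∧ ∃ p, A.multiplicity p = m} := by
      refine ⟨d, ?_⟩
      rintro _ ⟨-, p, rfl⟩
      exact A.multiplicity_le p
    obtain ⟨h2, p, hp⟩ := Nat.sSup_mem h hbdd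
    change 2 ≤ A.maxMultiplicity at h2
    change A.multiplicity p = A.maxMultiplicity at hp
    have hmem : ∀ i, p.submodule ≤ A.line i ↔ ∑ l, A.coeff i l * p.rep l = 0 := by
      intro i
      rw [Projectivization.submodule_eq, Submodule.span_singleton_le_iff_mem, mem_line]
    rw [← hp] at h2
    obtain ⟨i, hi, j, hj, hij⟩ := (Set.one_lt_ncard (Set.toFinite _)).1 h2
    refine ⟨i, j, hij, (hm.trans_eq hp.symm).trans ?_⟩
    rw [multiplicity, ← Set.ncard_coe_finset]
    refine Set.ncard_le_ncard ?_ (Set.toFinite _)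
    intro k hk
    rw [Finset.mem_coe, mem_linesThrough, ← A.sum_mul_eq_zero_iff_mem_span hij p.rep_nonzero
      ((hmem i).1 hi) ((hmem j).1 hj)]
    exact (hmem k).1 hk

theorem exists_point_on_line (A : LineArrangement d) (i : Fin d) :
    ∃ p : Fin 3 → ℂ, p ≠ 0 ∧ ∑ l, A.coeff i l * p l = 0 := by
  have hker := LinearMap.ker_ne_bot_of_finrank_lt
    (f := dotProductEquiv ℂ (Fin 3) (A.coeff i)) (by simp)
  obtain ⟨p, hp, hp0⟩ := Submodule.exists_mem_ne_zero_of_ne_bot hker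
  exact ⟨p, hp0, hp⟩

/-- For the empty arrangement every triple is a syzygy, and the rank is three instead of two. -/
theorem not_isFreeWithExponents_one (d₁ d₂ : ℕ) : ¬ IsFreeWithExponents 1 d₁ d₂ := by
  rintro ⟨-, b, -⟩
  have htop : jacobianSyzygies 1 = ⊤ := by
    rw [eq_top_iff]
    intro a _
    rw [mem_jacobianSyzygies]
    simp
  have h1 := Module.finrank_eq_card_basis b
  rw [htop, finrank_top] at h1
  simp at h1

end LineArrangement

theorem theorem6p3 {d : ℕ} (A : LineArrangement d) (d₁ d₂ : ℕ)
    (hA : IsFreeWithExponents A.poly d₁ d₂) (hm : d₁ ≤ A.maxMultiplicity)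
    {d' : ℕ} (B : LineArrangement d')
    (hL : Nonempty (A.IntersectionLattice ≃o B.IntersectionLattice)) :
    IsFreeCurve B.poly := by
  obtain ⟨e⟩ := hL
  obtain ⟨σ, hσ⟩ := LineArrangement.exists_equiv_of_orderIso (A := A) (B := B) e.dual
  rcases le_or_gt 2 d with hd | hd
  · obtain ⟨i, j, hij, hcard⟩ := A.exists_linesThrough_of_le_maxMultiplicity hd hm
    obtain ⟨p, hp, hpi, hpj⟩ := A.exists_point hij
    obtain ⟨p', hp', hpi', hpj'⟩ := B.exists_point (σ.injective.ne hij)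
    have hA' := A.sum_mul_eq_zero_iff_mem_span hij hp hpi hpj
    have hB' := B.sum_mul_eq_zero_iff_mem_span (σ.injective.ne hij) hp' hpi' hpj'
    refine LineArrangement.isFreeCurve_of_incidence hA σ hσ hp hp' (fun k => ?_)
      (s := A.linesThrough i j) (fun k hk => ?_) ⟨i, A.left_mem_linesThrough i j⟩ hcard
    · rw [hA', hB', hσ]
    · rw [hA', ← A.mem_linesThrough]
      exact hk
  -- At most one line leaves no intersection point, so `m(𝒜) = 0`. For a single line, any of its
  -- points can play the role of the point of high multiplicity.
  · have hd₁ : d₁ = 0 := by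
      have hempty : {m : ℕ | 2 ≤ m ∧ ∃ p, A.multiplicity p = m} = ∅ := by
        ext m
        simp only [Set.mem_ofPred_eq, Set.mem_empty_iff_false, iff_false]
        rintro ⟨h2, p, rfl⟩
        have := A.multiplicity_le p
        omega
      rw [LineArrangement.maxMultiplicity, hempty, csSup_empty] at hm
      exact Nat.le_zero.1 hm
    obtain rfl | rfl : d = 0 ∨ d = 1 := by omega
    · refine absurd hA ?_
      rw [LineArrangement.poly, Fin.prod_univ_zero]
      exact LineArrangement.not_isFreeWithExponents_one _ _
    · obtain ⟨p, hp, hp0⟩ := A.exists_point_on_line 0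
      obtain ⟨p', hp', hp0'⟩ := B.exists_point_on_line (σ 0)
      refine LineArrangement.isFreeCurve_of_incidence hA σ hσ hp hp' (fun k => ?_)
        (s := {0}) (fun k _ => ?_) (by simp) (by omega)
      · rw [Subsingleton.elim k 0]
        exact ⟨fun _ => hp0', fun _ => hp0⟩
      · rw [Subsingleton.elim k 0]
        exact hp0
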